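/- \textbf{Conventions.} Let $n\ge 1$. A weight on $\mathbb R^n$ is a non-negative locally integrable function $w$. Averages and suprema take values in $[0,\infty]$, with $0\cdot\infty=0$ and $1/0=\infty$. For a weight $v$ on $\mathbb R$ and $1<p<\infty$ put $$[v]_{A_p}=\sup_I\Big(\frac1{|I|}\int_I v\Big)\Big(\frac1{|I|}\int_I v^{-\frac1{p-1}}\Big)^{p-1},\qquad [v]_{A_1}=\sup_I\Big(\frac1{|I|}\int_I v\Big)\operatorname*{ess\,sup}_I v^{-1},\qquad [v]_{A_\infty}=\sup_I\frac1{v(I)}\int_I M(v\mathbf 1_I),$$ where $I$ runs over the bounded intervals of positive length, $v(I)=\int_I v$ (intervals with $v(I)=0$ contribute $0$ to the last supremum), and $M$ is the non-centered Hardy--Littlewood maximal operator on $\mathbb R$. For a weight $w$ on $\mathbb R^n$, $1\le j\le n$ and $\bar x^j=(x_1,\dots,x_{j-1},x_{j+1},\dots,x_n)\in\mathbb R^{n-1}$ let $w_{\bar x^j}(t)=w(x_1,\dots,x_{j-1},t,x_{j+1},\dots,x_n)$, and for $1\le p\le\infty$ define $$[w]_{A_p^*}=\sup_{1\le j\le n}\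 \operatorname*{ess\,sup}_{\bar x^j\in\mathbb R^{n-1}}\,[w_{\bar x^j}]_{A_p}.$$ The class $A_\infty^*$ consists of the weights $w$ on $\mathbb R^n$ with $[w]_{A_\infty^*}<\infty$. For $1\le p<\infty$ the class $A_p^*$ consists of the weights $w$ on $\mathbb R^n$ for which the supremum defining $[\,\cdot\,]_{A_p}$, taken over all bounded non-degenerate rectangular parallelepipeds in $\mathbb R^n$ with sides parallel to the coordinate axes in place of intervals, is finite. \textbf{Theorem.} There exists a numerical constant $c>0$ such that for every $n\ge1$, every weight $w\in A_\infty^*$ on $\mathbb R^n$ and every real $p\ge e^{c[w]_{A_\infty^*}}$ we have $$w\in A_p^*\qquad\text{and}\qquad [w]_{A_p^*}\le \exp\!\big(\exp\!\big(c\,p\,[w]_{A_\infty^*}\big)\big).$$ -/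

import Mathlib

open MeasureTheory Set
open scoped ENNReal

noncomputable section

namespace StrongWeights

/-- A weight on a space with a topology and a volume: a non-negative, locally integrable function. -/
def IsWeight {α : Type*} [TopologicalSpace α] [MeasureSpace α] (w : α → ℝ) : Prop :=
  (∀ x, 0 ≤ w x) ∧ LocallyIntegrable w volume

/-- The Muckenhoupt expression of `w` on the set `Q`, for `1 ≤ p < ∞`:
`(|Q|⁻¹ ∫_Q w) (|Q|⁻¹ ∫_Q w ^ (-1/(p-1))) ^ (p-1)` if `p > 1`, and
`(|Q|⁻¹ ∫_Q w) (ess sup_Q w⁻¹)` if `p = 1`.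
Values are in `[0, ∞]`, with `0⁻¹ = ∞` and `0 * ∞ = 0`. -/
def apExpr {α : Type*} [MeasureSpace α] (p : ℝ) (w : α → ℝ) (Q : Set α) : ℝ≥0∞ :=
  (⨍⁻ x in Q, ENNReal.ofReal (w x) ∂volume) *
    if p = 1 then essSup (fun x => (ENNReal.ofReal (w x))⁻¹) (volume.restrict Q)
    else (⨍⁻ x in Q, ENNReal.ofReal (w x) ^ (-(1 / (p - 1))) ∂volume) ^ (p - 1)

/-- `[v]_{A_p}` on the real line, `1 ≤ p < ∞`: supremum over all bounded intervals. -/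
def apConst (p : ℝ) (v : ℝ → ℝ) : ℝ≥0∞ :=
  ⨆ (a : ℝ) (b : ℝ) (_ : a < b), apExpr p v (Icc a b)

/-- The non-centered Hardy-Littlewood maximal function on the real line. -/
def maximalFun (f : ℝ → ℝ≥0∞) (x : ℝ) : ℝ≥0∞ :=
  ⨆ (a : ℝ) (b : ℝ) (_ : a < b) (_ : x ∈ Icc a b), ⨍⁻ y in Icc a b, f y ∂volume

/-- The Fujii-Wilson constant `[v]_{A_∞}` on the real line: the supremum over all bounded
intervals `I` of `v(I)⁻¹ ∫_I M(v 1_I)`; intervals with `v(I) = 0` contribute `0`. -/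
def aInftyConst (v : ℝ → ℝ) : ℝ≥0∞ :=
  ⨆ (a : ℝ) (b : ℝ) (_ : a < b),
    (∫⁻ x in Icc a b, maximalFun ((Icc a b).indicator fun y => ENNReal.ofReal (v y)) x) /
      ∫⁻ x in Icc a b, ENNReal.ofReal (v x)

/-- The one-dimensional slice `t ↦ w(x₁, …, x_{j-1}, t, x_{j+1}, …, x_{d+1})`, where `x` collects
the other `d` coordinates. -/
def slice {d : ℕ} (w : (Fin (d + 1) → ℝ) → ℝ) (j : Fin (d + 1)) (x : Fin d → ℝ) : ℝ → ℝ :=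
  fun t => w (j.insertNth t x)

/-- `[w]_{A_p^*}` on `ℝ^(d+1)`, `1 ≤ p < ∞`. -/
def strongApConst {d : ℕ} (p : ℝ) (w : (Fin (d + 1) → ℝ) → ℝ) : ℝ≥0∞ :=
  ⨆ j : Fin (d + 1), essSup (fun x : Fin d → ℝ => apConst p (slice w j x)) volume

/-- `[w]_{A_∞^*}` on `ℝ^(d+1)`. -/
def strongAInftyConst {d : ℕ} (w : (Fin (d + 1) → ℝ) → ℝ) : ℝ≥0∞ :=
  ⨆ j : Fin (d + 1), essSup (fun x : Fin d → ℝ => aInftyConst (slice w j x)) volume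

/-- The `A_p` constant on `ℝⁿ` with respect to axis-parallel rectangular parallelepipeds. -/
def recApConst {n : ℕ} (p : ℝ) (w : (Fin n → ℝ) → ℝ) : ℝ≥0∞ :=
  ⨆ (a : Fin n → ℝ) (b : Fin n → ℝ) (_ : ∀ i, a i < b i), apExpr p w (Icc a b)

/-- The class `A_p^*` on `ℝⁿ`, `1 ≤ p < ∞`. -/
def MemStrongAp {n : ℕ} (p : ℝ) (w : (Fin n → ℝ) → ℝ) : Prop :=
  IsWeight w ∧ recApConst p w < ∞

/-- The class `A_∞^*` on `ℝ^(d+1)`. -/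
def MemStrongAInfty {d : ℕ} (w : (Fin (d + 1) → ℝ) → ℝ) : Prop :=
  IsWeight w ∧ strongAInftyConst w < ∞

end StrongWeights

end

namespace StrongWeights

open Filter Topology

/-! ### Dyadic stopping times -/

/-! On the line, let `v` have Fujii-Wilson constant at most `A`, with `A ≥ 1`. Calderón–Zygmund
stopping at the heights `2^k L`, where `L` is the mean of `v` on `I`, gives sets of which about `log
(u / L)` contribute to the mass at a point, whereas the integral of the maximal function only allows
about `A` of them. So little mass lies where `v` is much larger than `L`, and subsets of `I` of
relative length `1/K`, with `K` exponential in `A`, carry at most half of `v(I)`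
(`two_mul_measure_le`).

This property, `HalfMass`, has two consequences. It makes the measure doubling with constant `2^K`.
It also shows that the dyadic intervals on which the mean drops below `L/4` miss at least a fraction
`1/K` of `I`; by doubling, the mean on each maximal one is still at least `L / (4 * 2^K)`, so the
argument repeats inside it. Hence `{v < θ^k L}`, with `θ = 1 / (4 * 2^K)`, has relative measure at
most `(1 - 1/K)^k` (`measure_lt_le_pow`). Summing over `k`, the power `v^(-1/(p-1))` has the right
mean once `p - 1` is of order `K^2`, which is exponential in `A`, and `[v]_{A_p} ≤ (5K)^(p-1)`
(`apConst_le_exp`).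

For rectangles, the `A_p` condition is rewritten as `TestIneq`, which is linear in the weight. It
therefore survives integrating out a coordinate (`SliceTest.lintegral`), and induction on the
dimension gives it on boxes with constant `C^n` (`SliceTest.box`). Testing on a negative power of
the weight returns to the `A_p` condition (`recApConst_le_pow`). -/

open Classical in
/-- The union of the dyadic subintervals of `(a, b]` of generation at most `n` which satisfy `P`. -/
def stopSet (P : ℝ → ℝ → Prop) : ℕ → ℝ → ℝ → Set ℝ
  | 0, a, b => if P a b then Ioc a b else ∅
  | n + 1, a, b => if P a b then Ioc a b else
      stopSet P n a ((a + b) / 2) ∪ stopSet P n ((a + b) / 2) b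

lemma stopSet_of_stop {P : ℝ → ℝ → Prop} {a b : ℝ} (h : P a b) (n : ℕ) :
    stopSet P n a b = Ioc a b := by
  cases n <;> simp [stopSet, h]

lemma stopSet_succ {P : ℝ → ℝ → Prop} {a b : ℝ} (h : ¬ P a b) (n : ℕ) :
    stopSet P (n + 1) a b = stopSet P n a ((a + b) / 2) ∪ stopSet P n ((a + b) / 2) b := by
  simp [stopSet, h]

lemma stopSet_subset (P : ℝ → ℝ → Prop) (n : ℕ) {a b : ℝ} (hab : a < b) :
    stopSet P n a b ⊆ Ioc a b := by
  induction n generalizing a b with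
  | zero => by_cases h : P a b <;> simp [stopSet, h]
  | succ n ih =>
    by_cases h : P a b
    · rw [stopSet_of_stop h]
    · rw [stopSet_succ h]
      exact union_subset ((ih (by linarith)).trans (Ioc_subset_Ioc_right (by linarith)))
        ((ih (by linarith)).trans (Ioc_subset_Ioc_left (by linarith)))

lemma measurableSet_stopSet (P : ℝ → ℝ → Prop) (n : ℕ) (a b : ℝ) :
    MeasurableSet (stopSet P n a b) := by
  induction n generalizing a b with
  | zero => by_cases h : P a b <;> simp [stopSet, h]
  | succ n ih =>
    by_cases h : P a b
    · simp [stopSet_of_stop h]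
    · rw [stopSet_succ h]
      exact (ih _ _).union (ih _ _)

lemma stopSet_subset_succ (P : ℝ → ℝ → Prop) (n : ℕ) (a b : ℝ) :
    stopSet P n a b ⊆ stopSet P (n + 1) a b := by
  induction n generalizing a b with
  | zero => by_cases h : P a b <;> simp [stopSet, h]
  | succ n ih =>
    by_cases h : P a b
    · simp [stopSet_of_stop h]
    · rw [stopSet_succ h, stopSet_succ h (n + 1)]
      exact union_subset_union (ih _ _) (ih _ _)

lemma exists_stop_of_mem_stopSet {P : ℝ → ℝ → Prop} {n : ℕ} {a b x : ℝ} (hab : a < b)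
    (hx : x ∈ stopSet P n a b) :
    ∃ c d, c < d ∧ a ≤ c ∧ d ≤ b ∧ x ∈ Ioc c d ∧ P c d := by
  induction n generalizing a b with
  | zero =>
    by_cases h : P a b
    · rw [stopSet_of_stop h] at hx
      exact ⟨a, b, hab, le_rfl, le_rfl, hx, h⟩
    · simp [stopSet, h] at hx
  | succ n ih =>
    by_cases h : P a b
    · rw [stopSet_of_stop h] at hx
      exact ⟨a, b, hab, le_rfl, le_rfl, hx, h⟩
    · rw [stopSet_succ h] at hx
      rcases hx with hx | hx
      · obtain ⟨c, d, h1, h2, h3, h4⟩ := ih (by linarith) hx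
        exact ⟨c, d, h1, h2, by linarith, h4⟩
      · obtain ⟨c, d, h1, h2, h3, h4⟩ := ih (by linarith) hx
        exact ⟨c, d, h1, by linarith, h3, h4⟩

lemma exists_not_stop_of_notMem_stopSet {P : ℝ → ℝ → Prop} {n : ℕ} {a b x : ℝ}
    (hx : x ∈ Ioc a b) (hn : x ∉ stopSet P n a b) :
    ∃ c d, d - c = (b - a) / 2 ^ n ∧ x ∈ Ioc c d ∧ ¬ P c d := by
  induction n generalizing a b with
  | zero =>
    by_cases h : P a b
    · rw [stopSet_of_stop h] at hn
      exact absurd hx hn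
    · exact ⟨a, b, by simp, hx, h⟩
  | succ n ih =>
    by_cases h : P a b
    · rw [stopSet_of_stop h] at hn
      exact absurd hx hn
    · rw [stopSet_succ h, mem_union, not_or] at hn
      rcases le_or_gt x ((a + b) / 2) with hm | hm
      · obtain ⟨c, d, h1, h2⟩ := ih ⟨hx.1, hm⟩ hn.1
        exact ⟨c, d, by rw [h1, pow_succ]; field_simp; ring, h2⟩
      · obtain ⟨c, d, h1, h2⟩ := ih ⟨hm, hx.2⟩ hn.2
        exact ⟨c, d, by rw [h1, pow_succ]; field_simp; ring, h2⟩

/-- A stopping interval other than the root is a half of an unstopped interval, so comparing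
measures on such halves suffices; disjointness then adds up the bounds. The root has no parent and
needs `h0`. -/
lemma measure_stopSet_le {P : ℝ → ℝ → Prop} {μ ν : Measure ℝ} {C : ℝ≥0∞}
    (h : ∀ a b, a < b → ¬ P a b →
      (P a ((a + b) / 2) → μ (Ioc a ((a + b) / 2)) ≤ C * ν (Ioc a ((a + b) / 2))) ∧
      (P ((a + b) / 2) b → μ (Ioc ((a + b) / 2) b) ≤ C * ν (Ioc ((a + b) / 2) b)))
    (n : ℕ) {a b : ℝ} (hab : a < b) (h0 : P a b → μ (Ioc a b) ≤ C * ν (Ioc a b)) :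
    μ (stopSet P n a b) ≤ C * ν (stopSet P n a b) := by
  induction n generalizing a b with
  | zero =>
    by_cases hP : P a b
    · rw [stopSet_of_stop hP]
      exact h0 hP
    · simp [stopSet, hP]
  | succ n ih =>
    by_cases hP : P a b
    · rw [stopSet_of_stop hP]
      exact h0 hP
    · rw [stopSet_succ hP]
      have h1 : a < (a + b) / 2 := by linarith
      have h2 : (a + b) / 2 < b := by linarith
      have hd : Disjoint (stopSet P n a ((a + b) / 2)) (stopSet P n ((a + b) / 2) b) :=
        (Ioc_disjoint_Ioc_of_le le_rfl).mono (stopSet_subset P n h1) (stopSet_subset P n h2)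
      calc μ (stopSet P n a ((a + b) / 2) ∪ stopSet P n ((a + b) / 2) b)
          ≤ μ (stopSet P n a ((a + b) / 2)) + μ (stopSet P n ((a + b) / 2) b) :=
            measure_union_le _ _
        _ ≤ C * ν (stopSet P n a ((a + b) / 2)) + C * ν (stopSet P n ((a + b) / 2) b) :=
            add_le_add (ih h1 (h a b hab hP).1) (ih h2 (h a b hab hP).2)
        _ = _ := by rw [measure_union hd (measurableSet_stopSet P n _ _), mul_add]

/-- Calderón–Zygmund stopping: the union `Ω` of the maximal dyadic subintervals of `(a, b]` which
satisfy `P`. -/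
theorem exists_stopping (P : ℝ → ℝ → Prop) {a b : ℝ} (hab : a < b) :
    ∃ Ω : Set ℝ, MeasurableSet Ω ∧ Ω ⊆ Ioc a b ∧
      (∀ x ∈ Ω, ∃ c d, c < d ∧ a ≤ c ∧ d ≤ b ∧ x ∈ Ioc c d ∧ P c d) ∧
      (∀ x ∈ Ioc a b \ Ω, ∀ n : ℕ,
        ∃ c d, d - c = (b - a) / 2 ^ n ∧ x ∈ Ioc c d ∧ ¬ P c d) ∧
      ∀ (μ ν : Measure ℝ) (C : ℝ≥0∞),
        (∀ a b, a < b → ¬ P a b →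
          (P a ((a + b) / 2) → μ (Ioc a ((a + b) / 2)) ≤ C * ν (Ioc a ((a + b) / 2))) ∧
          (P ((a + b) / 2) b → μ (Ioc ((a + b) / 2) b) ≤ C * ν (Ioc ((a + b) / 2) b))) →
        (P a b → μ (Ioc a b) ≤ C * ν (Ioc a b)) → μ Ω ≤ C * ν Ω := by
  refine ⟨⋃ n, stopSet P n a b, .iUnion fun n => measurableSet_stopSet P n a b,
    iUnion_subset fun n => stopSet_subset P n hab, ?_, ?_, ?_⟩
  · intro x hx
    obtain ⟨n, hn⟩ := mem_iUnion.1 hx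
    exact exists_stop_of_mem_stopSet hab hn
  · intro x hx n
    exact exists_not_stop_of_notMem_stopSet hx.1 fun hn => hx.2 (mem_iUnion.2 ⟨n, hn⟩)
  · intro μ ν C h h0
    have hm : Monotone fun n => stopSet P n a b :=
      monotone_nat_of_le_succ fun n => stopSet_subset_succ P n a b
    rw [hm.measure_iUnion]
    refine iSup_le fun n => (measure_stopSet_le h n hab h0).trans ?_
    gcongr
    exact subset_iUnion (fun n => stopSet P n a b) n

/-- Lebesgue differentiation along dyadic intervals. -/
theorem ae_tendsto_measure_div {u : ℝ → ℝ≥0∞} (hu : Measurable u)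
    [IsLocallyFiniteMeasure (volume.withDensity u)] :
    ∀ᵐ x, ∀ (L : ℝ) (c d : ℕ → ℝ), 0 < L → (∀ n, d n - c n = L / 2 ^ n) →
      (∀ n, x ∈ Ioc (c n) (d n)) →
      Tendsto (fun n => volume.withDensity u (Ioc (c n) (d n)) / volume (Ioc (c n) (d n)))
        atTop (𝓝 (u x)) := by
  have h1 := (IsUnifLocDoublingMeasure.vitaliFamily (volume : Measure ℝ) 1).ae_tendsto_rnDeriv
    (ρ := volume.withDensity u)
  filter_upwards [h1, Measure.rnDeriv_withDensity volume hu] with x hx hux L c d hL hcd hmem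
  rw [hux] at hx
  have hlim : Tendsto (fun n : ℕ => L / 2 ^ n / 2) atTop (𝓝[>] 0) := by
    refine tendsto_nhdsWithin_iff.2 ⟨?_, .of_forall fun n => by simp only [mem_Ioi]; positivity⟩
    have := (tendsto_pow_atTop_nhds_zero_of_lt_one (r := (1 / 2 : ℝ)) (by norm_num)
      (by norm_num)).const_mul (L / 2)
    rw [mul_zero] at this
    refine this.congr fun n => ?_
    rw [one_div, inv_pow]; field_simp
  have hball : ∀ n, Metric.closedBall ((c n + d n) / 2) (L / 2 ^ n / 2) = Icc (c n) (d n) := by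
    intro n
    rw [Real.closedBall_eq_Icc, ← hcd n]
    congr 1 <;> ring
  -- The balls are centred at the midpoints of the intervals; with `K = 1` the point `x` only has to
  -- lie in them.
  have h2 := IsUnifLocDoublingMeasure.tendsto_closedBall_filterAt (μ := (volume : Measure ℝ))
    (K := 1) (x := x) (fun n => (c n + d n) / 2) (fun n : ℕ => L / 2 ^ n / 2) hlim
    (.of_forall fun n => by
      rw [one_mul, hball]
      exact Ioc_subset_Icc_self (hmem n))
  refine (hx.comp h2).congr fun n => ?_
  simp only [Function.comp, hball]
  rw [measure_congr (Ioc_ae_eq_Icc (μ := (volume : Measure ℝ))),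
    measure_congr ((withDensity_absolutelyContinuous volume u).ae_eq
      (Ioc_ae_eq_Icc (μ := (volume : Measure ℝ))))]

/-- The hypothesis at `x` is what `exists_stopping` provides off the stopping set. The exceptional
null set does not depend on `t`. -/
theorem ae_le_of_measure_le {u : ℝ → ℝ≥0∞} (hu : Measurable u)
    [IsLocallyFiniteMeasure (volume.withDensity u)] {a b : ℝ} (hab : a < b) :
    ∀ᵐ x, ∀ t : ℝ≥0∞,
      (∀ n : ℕ, ∃ c d, d - c = (b - a) / 2 ^ n ∧ x ∈ Ioc c d ∧
        volume.withDensity u (Ioc c d) ≤ t * volume (Ioc c d)) → u x ≤ t := by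
  filter_upwards [ae_tendsto_measure_div hu] with x hx t h
  choose c d h1 h2 h3 using h
  refine le_of_tendsto (hx (b - a) c d (by linarith) h1 h2) (.of_forall fun n => ?_)
  exact ENNReal.div_le_of_le_mul (h3 n)

theorem ae_ge_of_le_measure {u : ℝ → ℝ≥0∞} (hu : Measurable u)
    [IsLocallyFiniteMeasure (volume.withDensity u)] {a b : ℝ} (hab : a < b) :
    ∀ᵐ x, ∀ t : ℝ≥0∞,
      (∀ n : ℕ, ∃ c d, d - c = (b - a) / 2 ^ n ∧ x ∈ Ioc c d ∧
        t * volume (Ioc c d) ≤ volume.withDensity u (Ioc c d)) → t ≤ u x := by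
  filter_upwards [ae_tendsto_measure_div hu] with x hx t h
  choose c d h1 h2 h3 using h
  refine ge_of_tendsto (hx (b - a) c d (by linarith) h1 h2) (.of_forall fun n => ?_)
  have h0 := (h2 n).1.trans_le (h2 n).2
  rw [ENNReal.le_div_iff_mul_le (.inl ?_) (.inl (by simp))]
  · exact h3 n
  · simpa using h0

/-! ### From the Fujii-Wilson condition to absolute continuity -/

lemma sum_indicator_le {Ω : ℕ → Set ℝ} {L m : ℝ≥0∞} {x : ℝ}
    (h : ∀ k, x ∈ Ω k → 2 ^ k * L ≤ m) (N : ℕ) :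
    ∑ k ∈ Finset.range N, (Ω (k + 1)).indicator (fun _ => 2 ^ k * L) x ≤ m := by
  -- The second bound is the geometric series; it drives the induction, since at a point of `Ω (N +
  -- 1)` it gives `2 ^ (N + 1) * L`, which is at most `m`.
  suffices H : ∑ k ∈ Finset.range N, (Ω (k + 1)).indicator (fun _ => 2 ^ k * L) x ≤ m ∧
      ∑ k ∈ Finset.range N, (Ω (k + 1)).indicator (fun _ => 2 ^ k * L) x ≤ 2 ^ N * L from H.1
  induction N with
  | zero => simp
  | succ N ih =>
    rw [Finset.sum_range_succ]
    by_cases hx : x ∈ Ω (N + 1)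
    · have : ∑ k ∈ Finset.range N, (Ω (k + 1)).indicator (fun _ => 2 ^ k * L) x +
          (Ω (N + 1)).indicator (fun _ => 2 ^ N * L) x ≤ 2 ^ (N + 1) * L := by
        rw [indicator_of_mem hx, pow_succ, mul_two, add_mul]
        gcongr
        exact ih.2
      exact ⟨this.trans (h _ hx), this⟩
    · rw [indicator_of_notMem hx, add_zero]
      refine ⟨ih.1, ih.2.trans ?_⟩
      gcongr
      · norm_num
      · omega

/-- An unstopped parent has mean at most `t`, so a stopped half has mean at most `2 * t`. Off `Ω`
the means stay below `t` at all scales, and Lebesgue differentiation applies. -/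
theorem exists_upper_stopping {u : ℝ → ℝ≥0∞} (hu : Measurable u)
    [IsLocallyFiniteMeasure (volume.withDensity u)] {a b : ℝ} (hab : a < b) {t : ℝ≥0∞}
    (ht : volume.withDensity u (Ioc a b) ≤ t * volume (Ioc a b)) :
    ∃ Ω : Set ℝ, MeasurableSet Ω ∧ Ω ⊆ Ioc a b ∧
      (∀ x ∈ Ω, ∃ c d, c < d ∧ a ≤ c ∧ d ≤ b ∧ x ∈ Ioc c d ∧
        t * volume (Ioc c d) ≤ volume.withDensity u (Ioc c d)) ∧
      (∀ᵐ x, x ∈ Ioc a b \ Ω → u x ≤ t) ∧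
      volume.withDensity u Ω ≤ 2 * t * volume Ω := by
  obtain ⟨Ω, h1, h2, h3, h4, h5⟩ := exists_stopping
    (fun c d => t * volume (Ioc c d) < volume.withDensity u (Ioc c d)) hab
  refine ⟨Ω, h1, h2, ?_, ?_, ?_⟩
  · intro x hx
    obtain ⟨c, d, h6, h7, h8, h9, h10⟩ := h3 x hx
    exact ⟨c, d, h6, h7, h8, h9, h10.le⟩
  · filter_upwards [ae_le_of_measure_le hu hab] with x hx hxm
    refine hx t fun n => ?_
    obtain ⟨c, d, h6, h7, h8⟩ := h4 x hxm n
    exact ⟨c, d, h6, h7, not_lt.1 h8⟩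
  · refine h5 _ _ _ (fun c d hcd hP => ?_) fun hP => absurd ht hP.not_ge
    rw [not_lt] at hP
    have hv : ∀ l : ℝ, d - c = 2 * l → t * volume (Ioc c d) = 2 * t * ENNReal.ofReal l := by
      intro l hl
      rw [Real.volume_Ioc, hl, ENNReal.ofReal_mul (by norm_num), ENNReal.ofReal_ofNat]
      ring
    constructor <;> intro _
    · rw [Real.volume_Ioc, ← hv _ (by ring)]
      exact (measure_mono (Ioc_subset_Ioc_right (by linarith))).trans hP
    · rw [Real.volume_Ioc, ← hv _ (by ring)]
      exact (measure_mono (Ioc_subset_Ioc_left (by linarith))).trans hP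

/-- The set where `u` exceeds `2 ^ N * L` lies, up to a null set, in each of `Ω 1, …, Ω N`, so its
mass is counted `N` times, while the sum of the level contributions stays below `M` pointwise. -/
theorem nat_mul_measure_large_le {u : ℝ → ℝ≥0∞} (hu : Measurable u)
    [IsLocallyFiniteMeasure (volume.withDensity u)] {a b : ℝ} (hab : a < b) {L : ℝ≥0∞}
    (hL : volume.withDensity u (Ioc a b) = L * volume (Ioc a b)) {M : ℝ → ℝ≥0∞}
    (hM : ∀ c d x t, c < d → a ≤ c → d ≤ b → x ∈ Ioc c d →
      t * volume (Ioc c d) ≤ volume.withDensity u (Ioc c d) → t ≤ M x) (N : ℕ) :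
    N * volume.withDensity u (Ioc a b ∩ {x | 2 ^ N * L < u x}) ≤ 4 * ∫⁻ x in Ioc a b, M x := by
  have hex : ∀ k : ℕ, _ := fun k => exists_upper_stopping hu hab (t := 2 ^ k * L) (by
    rw [hL]
    gcongr
    exact le_mul_of_one_le_left' (one_le_pow₀ (by norm_num)))
  choose Ω h1 h2 h3 h4 h5 using hex
  have hB : ∀ k < N, volume.withDensity u (Ioc a b ∩ {x | 2 ^ N * L < u x}) ≤
      4 * (2 ^ k * L * volume (Ω (k + 1))) := by
    intro k hk
    calc volume.withDensity u (Ioc a b ∩ {x | 2 ^ N * L < u x})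
        ≤ volume.withDensity u (Ω (k + 1)) := by
          refine measure_mono_ae ?_
          filter_upwards [(withDensity_absolutelyContinuous volume u).ae_le (h4 (k + 1))]
            with x hx hxm
          by_contra hn
          have := hx ⟨hxm.1, hn⟩
          refine (this.trans ?_).not_gt hxm.2
          gcongr
          · norm_num
          · omega
      _ ≤ 2 * (2 ^ (k + 1) * L) * volume (Ω (k + 1)) := h5 _
      _ = _ := by rw [pow_succ]; ring
  calc (N : ℝ≥0∞) * volume.withDensity u (Ioc a b ∩ {x | 2 ^ N * L < u x})
      = ∑ k ∈ Finset.range N, volume.withDensity u (Ioc a b ∩ {x | 2 ^ N * L < u x}) := by simp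
    _ ≤ ∑ k ∈ Finset.range N, 4 * (2 ^ k * L * volume (Ω (k + 1))) :=
      Finset.sum_le_sum fun k hk => hB k (Finset.mem_range.1 hk)
    _ = 4 * ∫⁻ x in Ioc a b, ∑ k ∈ Finset.range N,
          (Ω (k + 1)).indicator (fun _ => 2 ^ k * L) x := by
      rw [lintegral_finsetSum _ fun k _ => measurable_const.indicator (h1 _), Finset.mul_sum]
      refine Finset.sum_congr rfl fun k _ => ?_
      rw [lintegral_indicator_const (h1 _), Measure.restrict_apply (h1 _),
        inter_eq_left.2 (h2 _)]
    _ ≤ 4 * ∫⁻ x in Ioc a b, M x := by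
      gcongr with x
      refine sum_indicator_le (fun k hk => ?_) N
      obtain ⟨c, d, h6, h7, h8, h9, h10⟩ := h3 k x hk
      exact hM c d x _ h6 h7 h8 h9 h10

/-- Small subsets of an interval carry at most half of the mass. -/
theorem two_mul_measure_le {u : ℝ → ℝ≥0∞} (hu : Measurable u)
    [IsLocallyFiniteMeasure (volume.withDensity u)] {a b : ℝ} (hab : a < b) {M : ℝ → ℝ≥0∞}
    (hM : ∀ c d x t, c < d → a ≤ c → d ≤ b → x ∈ Ioc c d →
      t * volume (Ioc c d) ≤ volume.withDensity u (Ioc c d) → t ≤ M x) {N : ℕ} (hN : N ≠ 0)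
    (hA : 16 * ∫⁻ x in Ioc a b, M x ≤ N * volume.withDensity u (Ioc a b))
    {E : Set ℝ} (hE : MeasurableSet E) (hEI : E ⊆ Ioc a b)
    (hEs : 2 ^ (N + 2) * volume E ≤ volume (Ioc a b)) :
    2 * volume.withDensity u E ≤ volume.withDensity u (Ioc a b) := by
  set ν := volume.withDensity u with hν
  set L := ν (Ioc a b) / volume (Ioc a b) with hLdef
  have hv0 : volume (Ioc a b) ≠ 0 := by simpa using hab
  have hvt : volume (Ioc a b) ≠ ∞ := by simp
  have hL : ν (Ioc a b) = L * volume (Ioc a b) := (ENNReal.div_mul_cancel hv0 hvt).symm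
  have h1 := nat_mul_measure_large_le hu hab hL hM N
  have h2 : 4 * ν (Ioc a b ∩ {x | 2 ^ N * L < u x}) ≤ ν (Ioc a b) := by
    have hN0 : (N : ℝ≥0∞) ≠ 0 := by exact_mod_cast hN
    rw [← ENNReal.mul_le_mul_iff_right hN0 (ENNReal.natCast_ne_top N)]
    calc (N : ℝ≥0∞) * (4 * ν (Ioc a b ∩ {x | 2 ^ N * L < u x}))
        = 4 * (N * ν (Ioc a b ∩ {x | 2 ^ N * L < u x})) := by ring
      _ ≤ 4 * (4 * ∫⁻ x in Ioc a b, M x) := by gcongr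
      _ = 16 * ∫⁻ x in Ioc a b, M x := by ring
      _ ≤ _ := hA
  have hms : MeasurableSet {x | 2 ^ N * L < u x} := measurableSet_lt measurable_const hu
  -- On the remaining part of `E` the density is at most `2 ^ N * L`; the exponent `N + 2` in `hEs`
  -- makes this a quarter of the mass, the same share as in `h2`.
  have h3 : 4 * ν (E \ {x | 2 ^ N * L < u x}) ≤ ν (Ioc a b) := by
    calc 4 * ν (E \ {x | 2 ^ N * L < u x})
        = 4 * ∫⁻ x in E \ {x | 2 ^ N * L < u x}, u x := by
          rw [hν, withDensity_apply _ (hE.diff hms)]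
      _ ≤ 4 * ∫⁻ x in E \ {x | 2 ^ N * L < u x}, 2 ^ N * L := by
          gcongr 4 * ?_
          exact setLIntegral_mono measurable_const fun x hx => not_lt.1 hx.2
      _ ≤ 4 * (2 ^ N * L * volume E) := by
          rw [setLIntegral_const]
          gcongr
          exact sdiff_subset
      _ = L * (2 ^ (N + 2) * volume E) := by rw [pow_add]; ring
      _ ≤ L * volume (Ioc a b) := by gcongr
      _ = _ := hL.symm
  have h4 : ν E ≤ ν (Ioc a b ∩ {x | 2 ^ N * L < u x}) + ν (E \ {x | 2 ^ N * L < u x}) := by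
    rw [← measure_inter_add_sdiff E hms]
    gcongr
  have h5 : 2 * (2 * ν E) ≤ 2 * ν (Ioc a b) := by
    calc 2 * (2 * ν E) = 4 * ν E := by ring
      _ ≤ 4 * (ν (Ioc a b ∩ {x | 2 ^ N * L < u x}) + ν (E \ {x | 2 ^ N * L < u x})) := by
        gcongr
      _ ≤ ν (Ioc a b) + ν (Ioc a b) := by rw [mul_add]; gcongr
      _ = _ := (two_mul _).symm
  exact (ENNReal.mul_le_mul_iff_right (by norm_num) (by norm_num)).1 h5

/-! ### Doubling -/

/-- Subsets of an interval of relative length at most `K⁻¹` carry at most half of the mass. -/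
def HalfMass (ν : Measure ℝ) (K : ℕ) : Prop :=
  ∀ a b, a < b → ∀ E : Set ℝ, MeasurableSet E → E ⊆ Ioc a b →
    K * volume E ≤ volume (Ioc a b) → 2 * ν E ≤ ν (Ioc a b)

lemma HalfMass.le_two_mul {ν : Measure ℝ} [IsLocallyFiniteMeasure ν] {K : ℕ}
    (h : HalfMass ν K) {I J : Set ℝ} {a b c d : ℝ} (hab : a < b) (hJ : MeasurableSet J)
    (hI : Ioc a b = I ∪ J) (hl : J = Ioc c d) (hK : K * (d - c) ≤ b - a) :
    ν (Ioc a b) ≤ 2 * ν I := by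
  have h1 : 2 * ν J ≤ ν (Ioc a b) := by
    refine h a b hab J hJ (hI ▸ subset_union_right) ?_
    rw [hl, Real.volume_Ioc, Real.volume_Ioc, ← ENNReal.ofReal_natCast,
      ← ENNReal.ofReal_mul (by positivity)]
    exact ENNReal.ofReal_le_ofReal hK
  have h2 : ν (Ioc a b) ≤ ν I + ν J := by rw [hI]; exact measure_union_le _ _
  have hfin : ν (Ioc a b) ≠ ∞ := measure_Ioc_lt_top.ne
  have h3 : ν (Ioc a b) + ν (Ioc a b) ≤ 2 * ν I + ν (Ioc a b) := by
    calc ν (Ioc a b) + ν (Ioc a b) ≤ (ν I + ν J) + (ν I + ν J) := by gcongr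
      _ = 2 * ν I + 2 * ν J := by ring
      _ ≤ _ := by gcongr
  exact (ENNReal.add_le_add_iff_right hfin).1 h3

/-- The half interval grows to the whole one in `K` steps of length `(b - a) / (2K)`. Each added
piece is at most a fraction `1/K` of the interval reached, so each step at most doubles the mass. -/
lemma HalfMass.doubling_left {ν : Measure ℝ} [IsLocallyFiniteMeasure ν] {K : ℕ}
    (h : HalfMass ν K) (hK : K ≠ 0) {a b : ℝ} (hab : a < b) :
    ν (Ioc a b) ≤ 2 ^ K * ν (Ioc a ((a + b) / 2)) := by
  have hK0 : (0 : ℝ) < K := by positivity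
  set l := (b - a) / 2 / K with hl
  have hl0 : 0 < l := by have := sub_pos.2 hab; positivity
  have hKl : K * l = (b - a) / 2 := by rw [hl]; field_simp
  have key : ∀ i : ℕ, ν (Ioc a ((a + b) / 2 + i * l)) ≤ 2 ^ i * ν (Ioc a ((a + b) / 2)) := by
    intro i
    induction i with
    | zero => simp
    | succ i ih =>
      have hi : (0 : ℝ) ≤ i * l := by positivity
      have hi2 : (0 : ℝ) ≤ (i + 1) * l := by positivity
      have := h.le_two_mul (a := a) (b := (a + b) / 2 + (i + 1) * l)
        (I := Ioc a ((a + b) / 2 + i * l)) (by linarith) measurableSet_Ioc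
        (Ioc_union_Ioc_eq_Ioc (by linarith) (by linarith)).symm rfl
        (by rw [show (a + b) / 2 + (i + 1) * l - ((a + b) / 2 + i * l) = l by ring, hKl]; linarith)
      push_cast
      calc _ ≤ _ := this
        _ ≤ 2 * (2 ^ i * ν (Ioc a ((a + b) / 2))) := by gcongr
        _ = _ := by rw [pow_succ]; ring
  have := key K
  rwa [hKl, show (a + b) / 2 + (b - a) / 2 = b by ring] at this

lemma HalfMass.doubling_right {ν : Measure ℝ} [IsLocallyFiniteMeasure ν] {K : ℕ}
    (h : HalfMass ν K) (hK : K ≠ 0) {a b : ℝ} (hab : a < b) :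
    ν (Ioc a b) ≤ 2 ^ K * ν (Ioc ((a + b) / 2) b) := by
  have hK0 : (0 : ℝ) < K := by positivity
  set l := (b - a) / 2 / K with hl
  have hl0 : 0 < l := by have := sub_pos.2 hab; positivity
  have hKl : K * l = (b - a) / 2 := by rw [hl]; field_simp
  have key : ∀ i : ℕ, ν (Ioc ((a + b) / 2 - i * l) b) ≤ 2 ^ i * ν (Ioc ((a + b) / 2) b) := by
    intro i
    induction i with
    | zero => simp
    | succ i ih =>
      have hi : (0 : ℝ) ≤ i * l := by positivity
      have hi2 : (0 : ℝ) ≤ (i + 1) * l := by positivity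
      have := h.le_two_mul (a := (a + b) / 2 - (i + 1) * l) (b := b)
        (I := Ioc ((a + b) / 2 - i * l) b) (by linarith) measurableSet_Ioc
        (by rw [union_comm]; exact (Ioc_union_Ioc_eq_Ioc (by linarith) (by linarith)).symm) rfl
        (by rw [show (a + b) / 2 - i * l - ((a + b) / 2 - (i + 1) * l) = l by ring, hKl]; linarith)
      push_cast
      calc _ ≤ _ := this
        _ ≤ 2 * (2 ^ i * ν (Ioc ((a + b) / 2) b)) := by gcongr
        _ = _ := by rw [pow_succ]; ring
  have := key K
  rwa [hKl, show (a + b) / 2 - (b - a) / 2 = a by ring] at this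

/-! ### Decay of the lower distribution function -/

/-- Stopping when the mean falls below `l`, a quarter of the mean on the whole interval. The last
clause transfers a density bound for `S` from the stopping intervals to `Ω`; doubling is what keeps
their means from being too small. -/
theorem exists_lower_stopping {u : ℝ → ℝ≥0∞} (hu : Measurable u)
    [IsLocallyFiniteMeasure (volume.withDensity u)] {K : ℕ}
    (h : HalfMass (volume.withDensity u) K) (hK : K ≠ 0) {a b : ℝ} (hab : a < b) {l : ℝ≥0∞}
    (hl : volume.withDensity u (Ioc a b) = 4 * l * volume (Ioc a b)) (hl0 : l ≠ 0) :
    ∃ Ω : Set ℝ, MeasurableSet Ω ∧ Ω ⊆ Ioc a b ∧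
      (∀ᵐ x, x ∈ Ioc a b \ Ω → l ≤ u x) ∧
      volume Ω ≤ (1 - (K : ℝ≥0∞)⁻¹) * volume (Ioc a b) ∧
      ∀ (S : Set ℝ) (q : ℝ≥0∞),
        (∀ c d, c < d → l * volume (Ioc c d) ≤ 2 ^ K * volume.withDensity u (Ioc c d) →
          volume (Ioc c d ∩ S) ≤ q * volume (Ioc c d)) → volume (Ω ∩ S) ≤ q * volume Ω := by
  set ν := volume.withDensity u with hν
  have hv0 : volume (Ioc a b) ≠ 0 := by simpa using hab
  have hvt : volume (Ioc a b) ≠ ∞ := by simp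
  obtain ⟨Ω, h1, h2, h3, h4, h5⟩ := exists_stopping
    (fun c d => ν (Ioc c d) < l * volume (Ioc c d)) hab
  have hnot : ¬ ν (Ioc a b) < l * volume (Ioc a b) := by
    rw [not_lt, hl]
    gcongr
    exact le_mul_of_one_le_left' (by norm_num)
  refine ⟨Ω, h1, h2, ?_, ?_, ?_⟩
  · filter_upwards [ae_ge_of_le_measure hu hab] with x hx hxm
    refine hx l fun n => ?_
    obtain ⟨c, d, h6, h7, h8⟩ := h4 x hxm n
    exact ⟨c, d, h6, h7, not_lt.1 h8⟩
  · have h6 : ν Ω ≤ l * volume Ω :=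
      h5 ν volume l (fun c d _ _ => ⟨fun h => h.le, fun h => h.le⟩) fun h => absurd h hnot
    have h7 : 4 * ν Ω ≤ ν (Ioc a b) := by
      calc 4 * ν Ω ≤ 4 * (l * volume (Ioc a b)) := by
            gcongr
            exact h6.trans (by gcongr)
        _ = _ := by rw [hl, mul_assoc]
    have hfin : ν (Ioc a b) ≠ ∞ := measure_Ioc_lt_top.ne
    have hpos : ν (Ioc a b) ≠ 0 := by
      rw [hl]
      exact mul_ne_zero (mul_ne_zero (by norm_num) hl0) hv0
    -- Otherwise the complement of `Ω` would carry at most half of the mass and `Ω` at most a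
    -- quarter.
    have h8 : volume (Ioc a b) < K * volume (Ioc a b \ Ω) := by
      by_contra hn
      have h9 := h a b hab _ (measurableSet_Ioc.diff h1) sdiff_subset (not_lt.1 hn)
      have h10 : ν (Ioc a b) ≤ ν Ω + ν (Ioc a b \ Ω) := by
        rw [← measure_union' disjoint_sdiff_right h1, union_sdiff_cancel h2]
      have h11 : 4 * ν (Ioc a b) ≤ 3 * ν (Ioc a b) := by
        calc 4 * ν (Ioc a b) ≤ 4 * (ν Ω + ν (Ioc a b \ Ω)) := by gcongr
          _ = 4 * ν Ω + 2 * (2 * ν (Ioc a b \ Ω)) := by ring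
          _ ≤ ν (Ioc a b) + 2 * ν (Ioc a b) := by gcongr
          _ = _ := by ring
      rw [ENNReal.mul_le_mul_iff_left hpos hfin] at h11
      norm_num at h11
    have h9 : (K : ℝ≥0∞)⁻¹ * volume (Ioc a b) ≤ volume (Ioc a b \ Ω) := by
      rw [mul_comm, ← div_eq_mul_inv]
      exact ENNReal.div_le_of_le_mul' h8.le
    rw [ENNReal.sub_mul (fun _ _ => hvt), one_mul]
    refine ENNReal.le_sub_of_add_le_right (ENNReal.mul_ne_top (by simpa using hK) hvt) ?_
    calc volume Ω + (K : ℝ≥0∞)⁻¹ * volume (Ioc a b) ≤ volume Ω + volume (Ioc a b \ Ω) := by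
          gcongr
      _ = volume (Ioc a b) := by
        rw [← measure_union' disjoint_sdiff_right h1, union_sdiff_cancel h2]
  · intro S q hS
    have := h5 (volume.restrict S) volume q (fun c d hcd hP => ?_) fun h => absurd h hnot
    · rwa [Measure.restrict_apply h1] at this
    · rw [not_lt] at hP
      constructor <;> intro _ <;> rw [Measure.restrict_apply measurableSet_Ioc]
      -- The half inherits the lower bound from its unstopped parent through doubling; the extra
      -- factor 2 from the lengths is dropped.
      · refine hS _ _ (by linarith) (le_trans ?_ (hP.trans (h.doubling_left hK hcd)))
        gcongr
        linarith
      · refine hS _ _ (by linarith) (le_trans ?_ (hP.trans (h.doubling_right hK hcd)))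
        gcongr
        linarith

/-- Each round of lower stopping costs a factor `θ` in height and gains `1 - 1/K` in measure. The
hypothesis is kept free of the mean on the original interval so that the induction can restart on
every stopping interval. -/
theorem measure_lt_le_pow {u : ℝ → ℝ≥0∞} (hu : Measurable u)
    [IsLocallyFiniteMeasure (volume.withDensity u)] {K : ℕ}
    (h : HalfMass (volume.withDensity u) K) (hK : K ≠ 0) (k : ℕ) {t : ℝ≥0∞} {a b : ℝ}
    (hab : a < b)
    (ht : t * volume (Ioc a b) ≤ (4 * 2 ^ K : ℝ≥0∞)⁻¹ ^ k * volume.withDensity u (Ioc a b)) :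
    volume (Ioc a b ∩ {x | u x < t}) ≤ (1 - (K : ℝ≥0∞)⁻¹) ^ k * volume (Ioc a b) := by
  induction k generalizing a b with
  | zero =>
    rw [pow_zero, one_mul]
    exact measure_mono inter_subset_left
  | succ k ih =>
    set ν := volume.withDensity u with hν
    set θ : ℝ≥0∞ := (4 * 2 ^ K : ℝ≥0∞)⁻¹ with hθ
    have hv0 : volume (Ioc a b) ≠ 0 := by simpa using hab
    have hvt : volume (Ioc a b) ≠ ∞ := by simp
    rcases eq_or_ne (ν (Ioc a b)) 0 with h0 | h0
    · rw [h0, mul_zero, nonpos_iff_eq_zero, mul_eq_zero, or_iff_left hv0] at ht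
      simp [ht]
    have hθ4 : θ * (4 * 2 ^ K) = 1 :=
      ENNReal.inv_mul_cancel (by simp) (ENNReal.mul_ne_top (by simp) (by simp))
    have hθ1 : θ * 4 ≤ 1 := by
      calc θ * 4 ≤ θ * (4 * 2 ^ K) := by
            gcongr
            exact le_mul_of_one_le_right' (one_le_pow₀ (by norm_num))
        _ = 1 := hθ4
    set l := ν (Ioc a b) / (4 * volume (Ioc a b)) with hldef
    have hl : ν (Ioc a b) = 4 * l * volume (Ioc a b) := by
      rw [mul_comm 4 l, mul_assoc, hldef, ENNReal.div_mul_cancel]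
      · exact mul_ne_zero (by norm_num) hv0
      · exact ENNReal.mul_ne_top (by norm_num) hvt
    have hl0 : l ≠ 0 := by
      rintro h
      rw [h] at hl
      exact h0 (by simpa using hl)
    have htl : t ≤ θ ^ k * (θ * 4) * l := by
      rw [← ENNReal.mul_le_mul_iff_left hv0 hvt]
      refine ht.trans_eq ?_
      rw [hl, pow_succ]
      ring
    obtain ⟨Ω, h1, h2, h3, h4, h5⟩ := exists_lower_stopping hu h hK hab hl hl0
    have h6 : volume (Ω ∩ {x | u x < t}) ≤ (1 - (K : ℝ≥0∞)⁻¹) ^ k * volume Ω := by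
      refine h5 _ _ fun c d hcd hle => ih hcd ?_
      calc t * volume (Ioc c d) ≤ θ ^ k * (θ * 4) * l * volume (Ioc c d) := by gcongr
        _ = θ ^ k * (θ * 4) * (l * volume (Ioc c d)) := by ring
        _ ≤ θ ^ k * (θ * 4) * (2 ^ K * ν (Ioc c d)) := by gcongr
        _ = θ ^ k * ν (Ioc c d) * (θ * (4 * 2 ^ K)) := by ring
        _ = _ := by rw [hθ4, mul_one]
    have h7 : volume (Ioc a b ∩ {x | u x < t}) ≤ volume (Ω ∩ {x | u x < t}) := by
      refine measure_mono_ae ?_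
      filter_upwards [h3] with x hx hxm
      refine ⟨?_, hxm.2⟩
      by_contra hn
      refine ((hx ⟨hxm.1, hn⟩).trans_lt hxm.2).not_ge (htl.trans ?_)
      refine mul_le_of_le_one_left' (mul_le_one' (pow_le_one₀ (by positivity) ?_) hθ1)
      exact (le_mul_of_one_le_right' (by norm_num)).trans hθ1
    calc _ ≤ _ := h7
      _ ≤ _ := h6
      _ ≤ (1 - (K : ℝ≥0∞)⁻¹) ^ k * ((1 - (K : ℝ≥0∞)⁻¹) * volume (Ioc a b)) := by gcongr
      _ = _ := by rw [pow_succ, mul_assoc]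

/-! ### Integrability of negative powers -/

/-- For `0 < x < L`, the term of the shell `θ^(k+1) L ≤ x < θ^k L` alone dominates; for `x = 0`
every term is at least 1 and the series diverges. -/
lemma rpow_neg_le_tsum {θ L x : ℝ≥0∞} {s : ℝ} (hθ : θ < 1) (hθ0 : θ ≠ 0) (hs : 0 < s)
    (hL : L ≠ 0) (hLt : L ≠ ∞) :
    x ^ (-s) ≤ L ^ (-s) * (1 + ∑' k : ℕ, (θ ^ (-s)) ^ (k + 1) * if x < θ ^ k * L then 1 else 0) := by
  have hLs : L ^ (-s) ≠ 0 := by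
    rw [Ne, ENNReal.rpow_eq_zero_iff]
    rintro (⟨h, _⟩ | ⟨h, _⟩)
    · exact hL h
    · exact hLt h
  have hR : 1 ≤ θ ^ (-s) := by
    rw [ENNReal.rpow_neg]
    exact ENNReal.one_le_inv.2 (ENNReal.rpow_le_one hθ.le hs.le)
  rcases le_or_gt L x with hx | hx
  · calc x ^ (-s) ≤ L ^ (-s) := by
          rw [ENNReal.rpow_neg, ENNReal.rpow_neg]
          exact ENNReal.inv_le_inv.2 (ENNReal.rpow_le_rpow hx hs.le)
      _ ≤ _ := le_mul_of_one_le_right' le_self_add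
  rcases eq_or_ne x 0 with rfl | hx0
  · have : ∑' k : ℕ, (θ ^ (-s)) ^ (k + 1) * (if 0 < θ ^ k * L then 1 else 0 : ℝ≥0∞) = ∞ := by
      rw [eq_top_iff, ← ENNReal.tsum_const_eq_top_of_ne_zero (α := ℕ) (one_ne_zero)]
      refine ENNReal.tsum_le_tsum fun k => ?_
      rw [if_pos (pos_iff_ne_zero.2 (mul_ne_zero (pow_ne_zero _ hθ0) hL)), mul_one]
      exact one_le_pow₀ hR
    rw [this, add_top, ENNReal.mul_top hLs]
    exact le_top
  · have hex : ∃ k : ℕ, θ ^ (k + 1) * L ≤ x := by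
      have h1 : Tendsto (fun k : ℕ => θ ^ (k + 1) * L) atTop (𝓝 (0 * L)) :=
        ENNReal.Tendsto.mul_const ((tendsto_add_atTop_iff_nat 1).2
          (ENNReal.tendsto_pow_atTop_nhds_zero_of_lt_one hθ)) (.inr hLt)
      rw [zero_mul] at h1
      obtain ⟨k, hk⟩ := (h1.eventually (gt_mem_nhds (pos_iff_ne_zero.2 hx0))).exists
      exact ⟨k, hk.le⟩
    classical
    set k := Nat.find hex with hk
    have h1 : θ ^ (k + 1) * L ≤ x := Nat.find_spec hex
    have h2 : x < θ ^ k * L := by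
      rcases Nat.eq_zero_or_pos k with h0 | h0
      · simpa [h0] using hx
      · have := Nat.find_min hex (m := k - 1) (by omega)
        rwa [Nat.sub_add_cancel h0, not_le] at this
    calc x ^ (-s) ≤ (θ ^ (k + 1) * L) ^ (-s) := by
          rw [ENNReal.rpow_neg, ENNReal.rpow_neg]
          exact ENNReal.inv_le_inv.2 (ENNReal.rpow_le_rpow h1 hs.le)
      _ = L ^ (-s) * ((θ ^ (-s)) ^ (k + 1) * if x < θ ^ k * L then 1 else 0) := by
        rw [if_pos h2, mul_one, ENNReal.mul_rpow_of_ne_zero (pow_ne_zero _ hθ0) hL, mul_comm,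
          ← ENNReal.rpow_natCast, ← ENNReal.rpow_natCast, ← ENNReal.rpow_mul, ← ENNReal.rpow_mul,
          mul_comm (-s)]
      _ ≤ _ := by
        gcongr
        refine le_trans ?_ le_add_self
        exact ENNReal.le_tsum (f := fun k : ℕ => (θ ^ (-s)) ^ (k + 1) *
          if x < θ ^ k * L then 1 else 0) k

lemma geometric_bound {K : ℕ} (hK : K ≠ 0) {s : ℝ} (hs : 0 < s)
    (hsK : 2 * K * (K + 2) * s ≤ 1) :
    1 + ∑' k : ℕ, ((4 * 2 ^ K : ℝ≥0∞)⁻¹ ^ (-s)) ^ (k + 1) * (1 - (K : ℝ≥0∞)⁻¹) ^ k ≤ 5 * K := by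
  -- With `x = 1/(2K)`, Bernoulli bounds the growth factor `2^((K+2)s)` by `1 + x`, and the decay
  -- factor is `1 - 2x`; the ratio of the series is thus at most `1 - x`.
  have hK1 : (1 : ℝ) ≤ K := by exact_mod_cast Nat.one_le_iff_ne_zero.2 hK
  set x : ℝ := 1 / (2 * K) with hx
  have hx0 : 0 < x := by positivity
  have hx1 : x ≤ 1 / 2 := by
    rw [hx]
    exact one_div_le_one_div_of_le (by norm_num) (by linarith)
  have hKx : (K : ℝ)⁻¹ = 2 * x := by rw [hx]; field_simp
  have hR : (4 * 2 ^ K : ℝ≥0∞)⁻¹ ^ (-s) ≤ ENNReal.ofReal (1 + x) := by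
    have h1 : (4 * 2 ^ K : ℝ≥0∞) = ENNReal.ofReal (2 ^ ((K : ℝ) + 2)) := by
      rw [Real.rpow_add (by norm_num), Real.rpow_natCast, ENNReal.ofReal_mul (by positivity),
        ENNReal.ofReal_pow (by norm_num), mul_comm]
      norm_num
    rw [ENNReal.rpow_neg, ENNReal.inv_rpow, inv_inv, h1,
      ENNReal.ofReal_rpow_of_nonneg (by positivity) hs.le, ← Real.rpow_mul (by norm_num)]
    apply ENNReal.ofReal_le_ofReal
    have h2 : ((K : ℝ) + 2) * s ≤ x := by
      rw [hx, le_div_iff₀ (by positivity)]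
      linarith
    have h3 := rpow_one_add_le_one_add_mul_self (s := 1) (p := ((K : ℝ) + 2) * s) (by norm_num)
      (by positivity) (by linarith)
    norm_num at h3
    linarith
  have hq : 1 - (K : ℝ≥0∞)⁻¹ = ENNReal.ofReal (1 - 2 * x) := by
    rw [ENNReal.ofReal_sub _ (by positivity), ENNReal.ofReal_one, ← hKx,
      ENNReal.ofReal_inv_of_pos (by linarith), ENNReal.ofReal_natCast]
  set R := (4 * 2 ^ K : ℝ≥0∞)⁻¹ ^ (-s)
  have hRq : R * (1 - (K : ℝ≥0∞)⁻¹) ≤ ENNReal.ofReal (1 - x) := by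
    calc R * (1 - (K : ℝ≥0∞)⁻¹) ≤ ENNReal.ofReal (1 + x) * ENNReal.ofReal (1 - 2 * x) := by
          rw [hq]; gcongr
      _ = ENNReal.ofReal ((1 + x) * (1 - 2 * x)) := (ENNReal.ofReal_mul (by linarith)).symm
      _ ≤ _ := ENNReal.ofReal_le_ofReal (by nlinarith)
  have hinv : (1 - R * (1 - (K : ℝ≥0∞)⁻¹))⁻¹ ≤ 2 * K := by
    calc (1 - R * (1 - (K : ℝ≥0∞)⁻¹))⁻¹ ≤ (ENNReal.ofReal x)⁻¹ := by
          refine ENNReal.inv_le_inv.2 ?_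
          calc ENNReal.ofReal x = 1 - ENNReal.ofReal (1 - x) := by
                rw [← ENNReal.ofReal_one, ← ENNReal.ofReal_sub _ (by linarith)]
                congr 1
                ring
            _ ≤ _ := by gcongr
      _ = 2 * K := by
        rw [← ENNReal.ofReal_inv_of_pos hx0, hx, one_div, inv_inv,
          ENNReal.ofReal_mul (by norm_num), ENNReal.ofReal_natCast, ENNReal.ofReal_ofNat]
  have hsum : ∑' k : ℕ, R ^ (k + 1) * (1 - (K : ℝ≥0∞)⁻¹) ^ k ≤ 4 * K := by
    calc ∑' k : ℕ, R ^ (k + 1) * (1 - (K : ℝ≥0∞)⁻¹) ^ k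
        = R * (1 - R * (1 - (K : ℝ≥0∞)⁻¹))⁻¹ := by
          rw [← ENNReal.tsum_geometric, ← ENNReal.tsum_mul_left]
          refine tsum_congr fun k => ?_
          rw [mul_pow, pow_succ]
          ring
      _ ≤ 2 * (2 * K) := by
        gcongr
        refine hR.trans ?_
        rw [← ENNReal.ofReal_ofNat]
        exact ENNReal.ofReal_le_ofReal (by linarith)
      _ = 4 * K := by ring
  calc _ ≤ (K : ℝ≥0∞) + 4 * K := by
        gcongr
        exact_mod_cast Nat.one_le_iff_ne_zero.2 hK
    _ = _ := by ring

theorem lintegral_rpow_neg_le {u : ℝ → ℝ≥0∞} (hu : Measurable u)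
    [IsLocallyFiniteMeasure (volume.withDensity u)] {K : ℕ}
    (h : HalfMass (volume.withDensity u) K) (hK : K ≠ 0) {s : ℝ} (hs : 0 < s)
    (hsK : 2 * K * (K + 2) * s ≤ 1) {a b : ℝ} (hab : a < b) {L : ℝ≥0∞}
    (hL : volume.withDensity u (Ioc a b) = L * volume (Ioc a b)) (hL0 : L ≠ 0) (hLt : L ≠ ∞) :
    ∫⁻ x in Ioc a b, u x ^ (-s) ≤ 5 * K * L ^ (-s) * volume (Ioc a b) := by
  set θ : ℝ≥0∞ := (4 * 2 ^ K : ℝ≥0∞)⁻¹ with hθ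
  have hθ1 : θ < 1 := by
    rw [hθ, ENNReal.inv_lt_one]
    calc (1 : ℝ≥0∞) < 4 := by norm_num
      _ ≤ 4 * 2 ^ K := le_mul_of_one_le_right' (one_le_pow₀ (by norm_num))
  have hθ0 : θ ≠ 0 := ENNReal.inv_ne_zero.2 (ENNReal.mul_ne_top (by simp) (by simp))
  have hms : ∀ k : ℕ, MeasurableSet {x | u x < θ ^ k * L} :=
    fun k => measurableSet_lt hu measurable_const
  have hmi : ∀ k : ℕ, Measurable fun x => if u x < θ ^ k * L then (1 : ℝ≥0∞) else 0 :=
    fun k => Measurable.ite (hms k) measurable_const measurable_const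
  calc ∫⁻ x in Ioc a b, u x ^ (-s)
      ≤ ∫⁻ x in Ioc a b, L ^ (-s) *
          (1 + ∑' k : ℕ, (θ ^ (-s)) ^ (k + 1) * if u x < θ ^ k * L then 1 else 0) :=
        lintegral_mono fun x => rpow_neg_le_tsum hθ1 hθ0 hs hL0 hLt
    _ = L ^ (-s) * (volume (Ioc a b) + ∑' k : ℕ, (θ ^ (-s)) ^ (k + 1) *
          volume (Ioc a b ∩ {x | u x < θ ^ k * L})) := by
      rw [lintegral_const_mul, lintegral_add_left measurable_const, lintegral_one,
        Measure.restrict_apply_univ, lintegral_tsum]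
      · congr 3
        funext k
        rw [lintegral_const_mul _ (hmi k)]
        congr 1
        have : (fun x => if u x < θ ^ k * L then (1 : ℝ≥0∞) else 0) =
            {x | u x < θ ^ k * L}.indicator 1 := by
          funext x
          simp [indicator_apply]
        rw [this, lintegral_indicator_one (hms k), Measure.restrict_apply (hms k), inter_comm]
      · exact fun k => ((hmi k).const_mul _).aemeasurable
      · exact measurable_const.add (Measurable.tsum fun k => (hmi k).const_mul _)
    _ ≤ L ^ (-s) * (volume (Ioc a b) + ∑' k : ℕ, (θ ^ (-s)) ^ (k + 1) *
          ((1 - (K : ℝ≥0∞)⁻¹) ^ k * volume (Ioc a b))) := by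
      gcongr with k
      refine measure_lt_le_pow hu h hK k hab ?_
      rw [hL, mul_assoc]
    _ = L ^ (-s) * (1 + ∑' k : ℕ, (θ ^ (-s)) ^ (k + 1) * (1 - (K : ℝ≥0∞)⁻¹) ^ k) *
          volume (Ioc a b) := by
      simp_rw [← mul_assoc]
      rw [ENNReal.tsum_mul_right, mul_assoc, add_mul, one_mul]
    _ ≤ L ^ (-s) * (5 * K) * volume (Ioc a b) := by
      gcongr
      exact geometric_bound hK hs hsK
    _ = _ := by ring

/-! ### The one-dimensional theorem -/

lemma div_le_aInftyConst (v : ℝ → ℝ) {a b : ℝ} (hab : a < b) :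
    (∫⁻ x in Icc a b, maximalFun ((Icc a b).indicator fun y => ENNReal.ofReal (v y)) x) /
      ∫⁻ x in Icc a b, ENNReal.ofReal (v x) ≤ aInftyConst v := by
  refine le_iSup_of_le a (le_iSup_of_le b ?_)
  rw [iSup_pos hab]

lemma lintegral_maximalFun_le {v : ℝ → ℝ} {A : ℝ} (hA : aInftyConst v ≤ ENNReal.ofReal A)
    (hA0 : 0 < A) {a b : ℝ} (hab : a < b) :
    ∫⁻ x in Icc a b, maximalFun ((Icc a b).indicator fun y => ENNReal.ofReal (v y)) x ≤
      ENNReal.ofReal A * ∫⁻ x in Icc a b, ENNReal.ofReal (v x) := by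
  rw [← ENNReal.div_le_iff_le_mul (.inr ENNReal.ofReal_ne_top)
    (.inr (by simpa using hA0))]
  exact (div_le_aInftyConst v hab).trans hA

lemma laverage_le_maximalFun {f : ℝ → ℝ≥0∞} {a b c d x : ℝ} (hcd : c < d) (hac : a ≤ c)
    (hdb : d ≤ b) (hx : x ∈ Icc c d) :
    ⨍⁻ y in Icc c d, f y ∂volume ≤ maximalFun ((Icc a b).indicator f) x := by
  refine le_iSup_of_le c (le_iSup_of_le d (le_iSup_of_le hcd (le_iSup_of_le hx ?_)))
  rw [setLAverage_eq, setLAverage_eq]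
  gcongr ?_ / _
  refine (setLIntegral_congr_fun measurableSet_Icc fun y hy => ?_).le
  rw [indicator_of_mem (Icc_subset_Icc hac hdb hy)]

lemma lintegral_lt_top_of_locallyIntegrable {v : ℝ → ℝ} (hv : LocallyIntegrable v volume)
    (a b : ℝ) : ∫⁻ x in Icc a b, ENNReal.ofReal (v x) < ∞ :=
  ((hv.integrableOn_isCompact isCompact_Icc).lintegral_lt_top)

/-- On `I` the maximal function is at least the mean over `I`, so any interval of positive mass
forces the constant to be at least 1. -/
lemma lintegral_eq_zero_of_aInftyConst_lt_one {v : ℝ → ℝ} (hv : LocallyIntegrable v volume)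
    (hA : aInftyConst v < 1) {a b : ℝ} (hab : a < b) :
    ∫⁻ x in Icc a b, ENNReal.ofReal (v x) = 0 := by
  by_contra h0
  refine hA.not_ge (le_trans ?_ (div_le_aInftyConst v hab))
  rw [ENNReal.le_div_iff_mul_le (.inl h0)
    (.inl (lintegral_lt_top_of_locallyIntegrable hv a b).ne), one_mul]
  have hv0 : volume (Icc a b) ≠ 0 := by simpa using hab
  have hvt : volume (Icc a b) ≠ ∞ := by simp
  calc ∫⁻ x in Icc a b, ENNReal.ofReal (v x)
      = ∫⁻ _ in Icc a b, ⨍⁻ y in Icc a b, ENNReal.ofReal (v y) ∂volume := by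
        rw [setLIntegral_const, setLAverage_eq, ENNReal.div_mul_cancel hv0 hvt]
    _ ≤ _ := setLIntegral_mono' measurableSet_Icc fun x hx =>
      laverage_le_maximalFun hab le_rfl le_rfl hx

lemma apConst_eq_zero {v : ℝ → ℝ} (p : ℝ)
    (h : ∀ a b, a < b → ∫⁻ x in Icc a b, ENNReal.ofReal (v x) = 0) : apConst p v = 0 := by
  simp only [apConst, ENNReal.iSup_eq_zero]
  intro a b hab
  rw [apExpr, setLAverage_eq, h a b hab]
  simp

lemma halfMass_of_aInftyConst_le {v : ℝ → ℝ} {u : ℝ → ℝ≥0∞} (hu : Measurable u)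
    (huv : (fun x => ENNReal.ofReal (v x)) =ᵐ[volume] u)
    [IsLocallyFiniteMeasure (volume.withDensity u)] {A : ℝ} (hA0 : 0 < A)
    (hA : aInftyConst v ≤ ENNReal.ofReal A) {N : ℕ} (hN : 16 * A ≤ N) :
    HalfMass (volume.withDensity u) (2 ^ (N + 2)) := by
  intro a b hab E hE hEI hEs
  have hν : ∀ c d, volume.withDensity u (Ioc c d) = ∫⁻ x in Icc c d, ENNReal.ofReal (v x) := by
    intro c d
    rw [withDensity_apply _ measurableSet_Ioc, setLIntegral_congr Ioc_ae_eq_Icc]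
    exact lintegral_congr_ae (ae_restrict_of_ae huv.symm)
  have hN0 : N ≠ 0 := by
    rintro rfl
    norm_num at hN
    linarith
  refine two_mul_measure_le hu hab (N := N)
    (M := maximalFun ((Icc a b).indicator fun y => ENNReal.ofReal (v y))) ?_ hN0 ?_ hE hEI
    (by exact_mod_cast hEs)
  · intro c d x t hcd hac hdb hx ht
    refine le_trans ?_ (laverage_le_maximalFun hcd hac hdb (Ioc_subset_Icc_self hx))
    rw [setLAverage_eq, ENNReal.le_div_iff_mul_le (.inl (by simpa using hcd)) (.inl (by simp)),
      ← hν]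
    simpa using ht
  · rw [setLIntegral_congr Ioc_ae_eq_Icc, hν]
    calc _ ≤ 16 * (ENNReal.ofReal A * ∫⁻ x in Icc a b, ENNReal.ofReal (v x)) := by
          gcongr
          exact lintegral_maximalFun_le hA hA0 hab
      _ = ENNReal.ofReal (16 * A) * ∫⁻ x in Icc a b, ENNReal.ofReal (v x) := by
        rw [ENNReal.ofReal_mul (by norm_num), ENNReal.ofReal_ofNat, mul_assoc]
      _ ≤ _ := by
        gcongr
        rw [← ENNReal.ofReal_natCast]
        exact ENNReal.ofReal_le_ofReal hN

theorem apConst_le_of_aInftyConst_le {v : ℝ → ℝ} (hv : LocallyIntegrable v volume) {A : ℝ}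
    (hA0 : 0 < A) (hA : aInftyConst v ≤ ENNReal.ofReal A) {N : ℕ} (hN : 16 * A ≤ N) {p : ℝ}
    (hp : 2 * 2 ^ (N + 2) * (2 ^ (N + 2) + 2) ≤ p - 1) :
    apConst p v ≤ (5 * 2 ^ (N + 2)) ^ (p - 1) := by
  have hp1 : 0 < p - 1 := lt_of_lt_of_le (by positivity) hp
  have hae : AEMeasurable (fun x => ENNReal.ofReal (v x)) volume :=
    hv.aestronglyMeasurable.aemeasurable.ennreal_ofReal
  obtain ⟨u, hu, huv⟩ := hae
  have : IsLocallyFiniteMeasure (volume.withDensity u) := by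
    refine ⟨fun x => ⟨Icc (x - 1) (x + 1), Icc_mem_nhds (by linarith) (by linarith), ?_⟩⟩
    rw [withDensity_apply _ measurableSet_Icc,
      lintegral_congr_ae (ae_restrict_of_ae huv.symm)]
    exact lintegral_lt_top_of_locallyIntegrable hv _ _
  have hH := halfMass_of_aInftyConst_le hu huv hA0 hA hN
  refine iSup_le fun a => iSup_le fun b => iSup_le fun hab => ?_
  have hv0 : volume (Icc a b) ≠ 0 := by simpa using hab
  have hvt : volume (Icc a b) ≠ ∞ := by simp
  rw [apExpr, if_neg (by linarith)]
  set L := ⨍⁻ x in Icc a b, ENNReal.ofReal (v x) ∂volume with hL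
  rcases eq_or_ne L 0 with h0 | h0
  · rw [h0, zero_mul]
    exact zero_le
  have hLt : L ≠ ∞ := by
    rw [hL, setLAverage_eq]
    exact ENNReal.div_ne_top (lintegral_lt_top_of_locallyIntegrable hv a b).ne hv0
  have hLe : volume.withDensity u (Ioc a b) = L * volume (Ioc a b) := by
    rw [withDensity_apply _ measurableSet_Ioc, setLIntegral_congr Ioc_ae_eq_Icc,
      measure_congr Ioc_ae_eq_Icc, hL, setLAverage_eq, ENNReal.div_mul_cancel hv0 hvt]
    exact lintegral_congr_ae (ae_restrict_of_ae huv.symm)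
  have hs : 0 < 1 / (p - 1) := by positivity
  have key := lintegral_rpow_neg_le hu hH (by positivity) hs (by
    rw [mul_one_div, div_le_one hp1]
    exact_mod_cast hp) hab hLe h0 hLt
  have havg : ⨍⁻ x in Icc a b, ENNReal.ofReal (v x) ^ (-(1 / (p - 1))) ∂volume ≤
      5 * 2 ^ (N + 2) * L ^ (-(1 / (p - 1))) := by
    rw [setLAverage_eq]
    refine ENNReal.div_le_of_le_mul ?_
    have h1 : ∫⁻ x in Icc a b, ENNReal.ofReal (v x) ^ (-(1 / (p - 1))) =
        ∫⁻ x in Ioc a b, u x ^ (-(1 / (p - 1))) := by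
      rw [setLIntegral_congr Ioc_ae_eq_Icc]
      refine lintegral_congr_ae (ae_restrict_of_ae ?_)
      filter_upwards [huv] with x hx
      rw [hx]
    rw [h1, ← measure_congr (Ioc_ae_eq_Icc (μ := (volume : Measure ℝ)))]
    exact_mod_cast key
  calc _ ≤ L * (5 * 2 ^ (N + 2) * L ^ (-(1 / (p - 1)))) ^ (p - 1) := by gcongr
    _ = L * ((5 * 2 ^ (N + 2)) ^ (p - 1) * L⁻¹) := by
      rw [ENNReal.mul_rpow_of_nonneg _ _ hp1.le, ← ENNReal.rpow_mul, neg_mul, one_div,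
        inv_mul_cancel₀ hp1.ne', ENNReal.rpow_neg_one]
    _ = (5 * 2 ^ (N + 2)) ^ (p - 1) * (L * L⁻¹) := by ring
    _ = _ := by rw [ENNReal.mul_inv_cancel h0 hLt, mul_one]

/-- On the line, a Fujii-Wilson weight with constant at most `A` belongs to `A_p` as soon as
`p ≥ exp (100 * A)`. -/
theorem apConst_le_exp {v : ℝ → ℝ} (hv : LocallyIntegrable v volume) {A : ℝ} (hA1 : 1 ≤ A)
    (hA : aInftyConst v ≤ ENNReal.ofReal A) {p : ℝ} (hp : Real.exp (100 * A) ≤ p) :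
    apConst p v ≤ ENNReal.ofReal (Real.exp (Real.exp (100 * p * A))) := by
  set N := ⌈16 * A⌉₊ with hNdef
  have hN : 16 * A ≤ N := Nat.le_ceil _
  have hN' : (N : ℝ) < 16 * A + 1 := Nat.ceil_lt_add_one (by linarith)
  have h2e : (2 : ℝ) ≤ Real.exp 1 := by linarith [Real.add_one_le_exp 1]
  have hK : (2 : ℝ) ^ (N + 2) ≤ Real.exp (19 * A) := by
    calc (2 : ℝ) ^ (N + 2) ≤ Real.exp 1 ^ (N + 2) := by gcongr
      _ = Real.exp ((N : ℝ) + 2) := by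
        rw [← Real.exp_nat_mul]
        push_cast
        ring_nf
      _ ≤ _ := Real.exp_le_exp.2 (by linarith)
  have hK4 : (4 : ℝ) ≤ 2 ^ (N + 2) := by
    rw [pow_add]
    have : (1 : ℝ) ≤ 2 ^ N := one_le_pow₀ (by norm_num)
    linarith
  have h5 : (5 : ℝ) ≤ Real.exp 2 := by
    have h1 : Real.exp 2 = Real.exp 1 * Real.exp 1 := by rw [← Real.exp_add]; norm_num
    have h2 : (2.7 : ℝ) ≤ Real.exp 1 := by linarith [Real.exp_one_gt_d9]
    rw [h1]
    nlinarith
  have h5K : 5 * (2 : ℝ) ^ (N + 2) ≤ Real.exp (21 * A) := by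
    calc 5 * (2 : ℝ) ^ (N + 2) ≤ Real.exp 2 * Real.exp (19 * A) := by gcongr
      _ = Real.exp (2 + 19 * A) := (Real.exp_add _ _).symm
      _ ≤ _ := Real.exp_le_exp.2 (by linarith)
  have hpK : 2 * (2 : ℝ) ^ (N + 2) * (2 ^ (N + 2) + 2) ≤ p - 1 := by
    have h1 : (5 * (2 : ℝ) ^ (N + 2)) * (5 * 2 ^ (N + 2)) ≤ p := by
      calc (5 * (2 : ℝ) ^ (N + 2)) * (5 * 2 ^ (N + 2))
          ≤ Real.exp (21 * A) * Real.exp (21 * A) := by gcongr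
        _ = Real.exp (21 * A + 21 * A) := (Real.exp_add _ _).symm
        _ ≤ Real.exp (100 * A) := Real.exp_le_exp.2 (by linarith)
        _ ≤ p := hp
    nlinarith
  refine (apConst_le_of_aInftyConst_le hv (by linarith) hA hN hpK).trans ?_
  have hp1 : 0 ≤ p - 1 := le_trans (by positivity) hpK
  have h6 : (5 * 2 ^ (N + 2) : ℝ≥0∞) = ENNReal.ofReal (5 * 2 ^ (N + 2)) := by
    rw [ENNReal.ofReal_mul (by norm_num), ENNReal.ofReal_pow (by norm_num),
      ENNReal.ofReal_ofNat, ENNReal.ofReal_ofNat]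
  rw [h6, ENNReal.ofReal_rpow_of_nonneg (by positivity) hp1]
  apply ENNReal.ofReal_le_ofReal
  calc (5 * (2 : ℝ) ^ (N + 2)) ^ (p - 1) ≤ Real.exp (21 * A) ^ (p - 1) :=
        Real.rpow_le_rpow (by positivity) h5K hp1
    _ = Real.exp (21 * A * (p - 1)) := (Real.exp_mul _ _).symm
    _ ≤ _ := by
      -- A single exponential already bounds the constant here; the second one comes from `y ≤ exp
      -- y`.
      refine Real.exp_le_exp.2 (le_trans ?_ (Real.add_one_le_exp _))
      nlinarith

/-! ### Slicing -/

lemma measurable_insertNth {d : ℕ} (j : Fin (d + 1)) :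
    Measurable fun z : ℝ × (Fin d → ℝ) => (j.insertNth z.1 z.2 : Fin (d + 1) → ℝ) :=
  (MeasurableEquiv.piFinSuccAbove (fun _ => ℝ) j).symm.measurable

lemma measurePreserving_insertNth {d : ℕ} (j : Fin (d + 1)) :
    MeasurePreserving fun z : ℝ × (Fin d → ℝ) => (j.insertNth z.1 z.2 : Fin (d + 1) → ℝ) :=
  (volume_preserving_piFinSuccAbove (fun _ => ℝ) j).symm

lemma ae_ae_insertNth {d : ℕ} (j : Fin (d + 1)) {P : (Fin (d + 1) → ℝ) → Prop}
    (h : ∀ᵐ y, P y) : ∀ᵐ x : Fin d → ℝ, ∀ᵐ t : ℝ, P (j.insertNth t x) := by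
  have h1 := (measurePreserving_insertNth j).quasiMeasurePreserving.ae h
  have h2 := (Measure.measurePreserving_swap (μ := (volume : Measure (Fin d → ℝ)))
    (ν := (volume : Measure ℝ))).quasiMeasurePreserving.ae h1
  exact Measure.ae_ae_of_ae_prod h2

lemma insertNth_mem_Icc_neg {d : ℕ} {j : Fin (d + 1)} {t r : ℝ} {x : Fin d → ℝ} :
    (j.insertNth t x : Fin (d + 1) → ℝ) ∈ Icc (fun _ => -r) (fun _ => r) ↔
      t ∈ Icc (-r) r ∧ x ∈ Icc (fun _ => -r) (fun _ => r) := by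
  simp only [mem_Icc, Pi.le_def, j.forall_iff_succAbove, Fin.insertNth_apply_same,
    Fin.insertNth_apply_succAbove]
  tauto

/-- Fubini on the cubes `[-k, k]^(d+1)`, whose countably many exceptional sets are discarded
together. -/
lemma ae_locallyIntegrable_slice {d : ℕ} {w : (Fin (d + 1) → ℝ) → ℝ}
    (hw : LocallyIntegrable w volume) (j : Fin (d + 1)) :
    ∀ᵐ x : Fin d → ℝ, LocallyIntegrable (slice w j x) volume := by
  have h1 : ∀ k : ℕ, ∀ᵐ x : Fin d → ℝ, Integrable (fun t : ℝ =>
      (Icc (fun _ => -(k : ℝ)) (fun _ => (k : ℝ))).indicator w (j.insertNth t x)) := by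
    intro k
    have h2 : Integrable ((Icc (fun _ => -(k : ℝ)) (fun _ => (k : ℝ))).indicator w) volume :=
      (hw.integrableOn_isCompact isCompact_Icc).integrable_indicator measurableSet_Icc
    exact ((measurePreserving_insertNth j).integrable_comp_of_integrable h2).prod_left_ae
  filter_upwards [ae_all_iff.2 h1] with x hx
  intro t
  obtain ⟨k, hk⟩ := exists_nat_gt (‖x‖ + |t|)
  have hxk : ‖x‖ ≤ k := by linarith [abs_nonneg t]
  have hxm : x ∈ Icc (fun _ => -(k : ℝ)) (fun _ => (k : ℝ)) :=
    ⟨fun i => (abs_le.1 ((norm_le_pi_norm x i).trans hxk)).1,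
      fun i => (abs_le.1 ((norm_le_pi_norm x i).trans hxk)).2⟩
  have ht : |t| < k := by linarith [norm_nonneg x]
  refine ⟨Icc (-(k : ℝ)) k, Icc_mem_nhds (abs_lt.1 ht).1 (abs_lt.1 ht).2, ?_⟩
  rw [← integrable_indicator_iff measurableSet_Icc]
  refine (hx k).congr (.of_forall fun s => ?_)
  by_cases hs : s ∈ Icc (-(k : ℝ)) k
  · simp only [indicator_of_mem hs, indicator_of_mem (insertNth_mem_Icc_neg.2 ⟨hs, hxm⟩), slice]
  · simp only [indicator_of_notMem hs,
      indicator_of_notMem (fun h => hs (insertNth_mem_Icc_neg.1 h).1)]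

lemma setLIntegral_Icc_insertNth_zero {d : ℕ} (a b : Fin (d + 1) → ℝ)
    {f : (Fin (d + 1) → ℝ) → ℝ≥0∞} (hf : Measurable f) :
    ∫⁻ y in Icc a b, f y = ∫⁻ x in Icc (Fin.tail a) (Fin.tail b), ∫⁻ t in Icc (a 0) (b 0),
      f ((0 : Fin (d + 1)).insertNth t x) := by
  have hpre : (fun z : ℝ × (Fin d → ℝ) => ((0 : Fin (d + 1)).insertNth z.1 z.2 : Fin (d + 1) → ℝ))
      ⁻¹' Icc a b = Icc (a 0) (b 0) ×ˢ Icc (Fin.tail a) (Fin.tail b) := by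
    ext z
    simp only [mem_preimage, mem_prod, mem_Icc, Pi.le_def, Fin.forall_fin_succ,
      Fin.insertNth_zero', Fin.cons_zero, Fin.cons_succ, Fin.tail]
    tauto
  rw [← (measurePreserving_insertNth (0 : Fin (d + 1))).setLIntegral_comp_preimage
    measurableSet_Icc hf, hpre, Measure.volume_eq_prod, ← Measure.prod_restrict]
  exact lintegral_prod_symm
    (fun z : ℝ × (Fin d → ℝ) => f ((0 : Fin (d + 1)).insertNth z.1 z.2))
    (hf.comp (measurable_insertNth 0)).aemeasurable

lemma volume_Icc_succ {d : ℕ} (a b : Fin (d + 1) → ℝ) :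
    volume (Icc a b) = volume (Icc (a 0) (b 0)) * volume (Icc (Fin.tail a) (Fin.tail b)) := by
  rw [Real.volume_Icc_pi, Real.volume_Icc_pi, Real.volume_Icc, Fin.prod_univ_succ]
  rfl

lemma insertNth_succ_insertNth_zero {d : ℕ} (j : Fin (d + 1)) (s t : ℝ) (x : Fin d → ℝ) :
    (j.succ.insertNth s ((0 : Fin (d + 1)).insertNth t x) : Fin (d + 2) → ℝ) =
      (0 : Fin (d + 2)).insertNth t (j.insertNth s x) := by
  symm
  rw [Fin.eq_insertNth_iff, Fin.insertNth_zero', Fin.insertNth_zero', Fin.cons_succ,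
    Fin.insertNth_apply_same]
  refine ⟨rfl, ?_⟩
  funext i
  refine Fin.cases ?_ (fun i => ?_) i
  · simp [Fin.removeNth]
  · simp [Fin.removeNth]

/-! ### Testing inequalities -/

/-- The inequality `⟨g⟩_I ^ p ω(I) ≤ C ∫_I g ^ p ω` for all intervals `I` and all `g ≥ 0`. -/
def TestIneq (p : ℝ) (C : ℝ≥0∞) (ω : ℝ → ℝ≥0∞) : Prop :=
  ∀ a b : ℝ, a < b → ∀ g : ℝ → ℝ≥0∞, Measurable g →
    (∫⁻ t in Icc a b, g t) ^ p * ∫⁻ t in Icc a b, ω t ≤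
      C * volume (Icc a b) ^ p * ∫⁻ t in Icc a b, g t ^ p * ω t

/-- Almost all one-dimensional slices of `W` satisfy `TestIneq`. -/
def SliceTest (p : ℝ) (C : ℝ≥0∞) : (n : ℕ) → ((Fin n → ℝ) → ℝ≥0∞) → Prop
  | 0, _ => True
  | d + 1, W => ∀ j : Fin (d + 1), ∀ᵐ x : Fin d → ℝ, TestIneq p C fun t => W (j.insertNth t x)

lemma TestIneq.congr {p : ℝ} {C : ℝ≥0∞} {ω ω' : ℝ → ℝ≥0∞} (h : TestIneq p C ω)
    (hω : ω =ᵐ[volume] ω') : TestIneq p C ω' := by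
  intro a b hab g hg
  have h1 : ∫⁻ t in Icc a b, ω' t = ∫⁻ t in Icc a b, ω t :=
    lintegral_congr_ae (ae_restrict_of_ae hω.symm)
  have h2 : ∫⁻ t in Icc a b, g t ^ p * ω' t = ∫⁻ t in Icc a b, g t ^ p * ω t :=
    lintegral_congr_ae (ae_restrict_of_ae (by filter_upwards [hω] with t ht; rw [ht]))
  rw [h1, h2]
  exact h a b hab g hg

/-- Hölder applied to `g = (g u^(1/p)) u^(-1/p)`. Finiteness of the integral of the negative power
rules out zeros of `u`, almost everywhere, so that the splitting is legitimate. -/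
lemma lintegral_rpow_le_of_holder {μ : Measure ℝ} {p : ℝ} (hp : 1 < p) {g u : ℝ → ℝ≥0∞}
    (hg : AEMeasurable g μ) (hu : AEMeasurable u μ) (hut : ∀ᵐ x ∂μ, u x ≠ ∞)
    (hint : ∫⁻ x, u x ^ (-(1 / (p - 1))) ∂μ ≠ ∞) :
    (∫⁻ x, g x ∂μ) ^ p ≤
      (∫⁻ x, g x ^ p * u x ∂μ) * (∫⁻ x, u x ^ (-(1 / (p - 1))) ∂μ) ^ (p - 1) := by
  have hp0 : 0 < p := by linarith
  have hp1 : 0 < p - 1 := by linarith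
  have hpq : p.HolderConjugate (p / (p - 1)) := Real.HolderConjugate.conjExponent hp
  have hu0 : ∀ᵐ x ∂μ, u x ≠ 0 := by
    filter_upwards [ae_lt_top' (hu.pow_const _) hint] with x hx h0
    rw [h0, ENNReal.zero_rpow_of_neg (by rw [neg_lt_zero]; positivity)] at hx
    exact hx.ne rfl
  have h1 : ∫⁻ x, g x ∂μ = ∫⁻ x, (g x * u x ^ (1 / p)) * u x ^ (-(1 / p)) ∂μ := by
    refine lintegral_congr_ae ?_
    filter_upwards [hut, hu0] with x hxt hx0
    rw [mul_assoc, ← ENNReal.rpow_add _ _ hx0 hxt, add_neg_cancel, ENNReal.rpow_zero, mul_one]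
  have h2 := ENNReal.lintegral_mul_le_Lp_mul_Lq μ hpq (hg.mul (hu.pow_const (1 / p)))
    (hu.pow_const (-(1 / p)))
  have h3 : ∀ x, (g x * u x ^ (1 / p)) ^ p = g x ^ p * u x := by
    intro x
    rw [ENNReal.mul_rpow_of_nonneg _ _ hp0.le, ← ENNReal.rpow_mul, one_div_mul_cancel hp0.ne',
      ENNReal.rpow_one]
  have h4 : ∀ x, (u x ^ (-(1 / p))) ^ (p / (p - 1)) = u x ^ (-(1 / (p - 1))) := by
    intro x
    rw [← ENNReal.rpow_mul]
    congr 1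
    field_simp
  simp only [Pi.mul_apply, h3, h4] at h2
  rw [h1]
  calc _ ≤ _ := ENNReal.rpow_le_rpow h2 hp0.le
    _ = _ := by
      rw [ENNReal.mul_rpow_of_nonneg _ _ hp0.le, ← ENNReal.rpow_mul, ← ENNReal.rpow_mul,
        one_div_mul_cancel hp0.ne', ENNReal.rpow_one]
      congr 2
      field_simp

lemma testIneq_of_apConst_le {v : ℝ → ℝ} (hv : AEMeasurable v volume) {p : ℝ} (hp : 1 < p)
    {C : ℝ≥0∞} (hC : C ≠ ∞) (h : apConst p v ≤ C) :
    TestIneq p C fun t => ENNReal.ofReal (v t) := by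
  intro a b hab g hg
  have hp1 : 0 < p - 1 := by linarith
  have hI : apExpr p v (Icc a b) ≤ C :=
    le_trans (le_iSup_of_le a (le_iSup_of_le b (by rw [iSup_pos hab]))) h
  rw [apExpr, if_neg hp.ne', setLAverage_eq, setLAverage_eq] at hI
  have hv0 : volume (Icc a b) ≠ 0 := by simpa using hab
  have hvt : volume (Icc a b) ≠ ∞ := by simp
  set V := ∫⁻ t in Icc a b, ENNReal.ofReal (v t) with hV
  set X := ∫⁻ t in Icc a b, ENNReal.ofReal (v t) ^ (-(1 / (p - 1))) with hX
  rcases eq_or_ne V 0 with h0 | h0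
  · rw [h0, mul_zero]
    exact zero_le
  have hVd : V / volume (Icc a b) ≠ 0 := (ENNReal.div_pos h0 hvt).ne'
  have hXt : X ≠ ∞ := by
    intro hXe
    rw [hXe, ENNReal.top_div_of_ne_top hvt, ENNReal.top_rpow_of_pos hp1,
      ENNReal.mul_top hVd] at hI
    exact hC (top_le_iff.1 hI)
  have hH := lintegral_rpow_le_of_holder (μ := volume.restrict (Icc a b)) hp hg.aemeasurable
    hv.ennreal_ofReal.restrict (.of_forall fun _ => ENNReal.ofReal_ne_top) hXt
  have hvol : volume (Icc a b) * volume (Icc a b) ^ (p - 1) = volume (Icc a b) ^ p := by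
    nth_rewrite 1 [← ENNReal.rpow_one (volume (Icc a b))]
    rw [← ENNReal.rpow_add _ _ hv0 hvt]
    ring_nf
  have hVX : V * X ^ (p - 1) ≤ C * volume (Icc a b) ^ p := by
    calc V * X ^ (p - 1) = (V / volume (Icc a b) * volume (Icc a b)) *
          (X / volume (Icc a b) * volume (Icc a b)) ^ (p - 1) := by
          rw [ENNReal.div_mul_cancel hv0 hvt, ENNReal.div_mul_cancel hv0 hvt]
      _ = V / volume (Icc a b) * (X / volume (Icc a b)) ^ (p - 1) *
          (volume (Icc a b) * volume (Icc a b) ^ (p - 1)) := by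
        rw [ENNReal.mul_rpow_of_nonneg _ _ hp1.le]
        ring
      _ ≤ _ := by
        rw [hvol]
        gcongr
  calc _ ≤ (∫⁻ t in Icc a b, g t ^ p * ENNReal.ofReal (v t)) * X ^ (p - 1) * V := by gcongr
    _ = (V * X ^ (p - 1)) * ∫⁻ t in Icc a b, g t ^ p * ENNReal.ofReal (v t) := by ring
    _ ≤ _ := by gcongr

/-- Integrating out one coordinate preserves the testing inequality in the others. -/
lemma SliceTest.lintegral {p : ℝ} {C : ℝ≥0∞} {n : ℕ} {W : (Fin (n + 1) → ℝ) → ℝ≥0∞}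
    (hW : Measurable W) (h : SliceTest p C (n + 1) W) (α β : ℝ) :
    SliceTest p C n fun x => ∫⁻ t in Icc α β, W ((0 : Fin (n + 1)).insertNth t x) := by
  cases n with
  | zero => trivial
  | succ m =>
    intro j
    -- The null set of bad slices in direction `j.succ` is itself sliced along coordinate `0`: for
    -- almost every `x` the inequality holds for almost every `t`, and it can be integrated in `t`
    -- with `g` fixed.
    filter_upwards [ae_ae_insertNth 0 (h j.succ)] with x hx a b hab g hg
    have hmeas : Measurable fun z : ℝ × ℝ =>
        W ((0 : Fin (m + 2)).insertNth z.2 (j.insertNth z.1 x)) := by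
      refine hW.comp ((measurable_insertNth 0).comp (measurable_snd.prodMk ?_))
      exact (measurable_insertNth j).comp (measurable_fst.prodMk measurable_const)
    have hsec : ∀ t, Measurable fun s =>
        W ((0 : Fin (m + 2)).insertNth t (j.insertNth s x)) := fun t =>
      hmeas.comp (measurable_id.prodMk measurable_const)
    have hmeas' : Measurable fun z : ℝ × ℝ =>
        W ((0 : Fin (m + 2)).insertNth z.1 (j.insertNth z.2 x)) := hmeas.comp measurable_swap
    simp only [insertNth_succ_insertNth_zero] at hx
    have h1 : ∫⁻ s in Icc a b, ∫⁻ t in Icc α β,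
          W ((0 : Fin (m + 2)).insertNth t (j.insertNth s x)) =
        ∫⁻ t in Icc α β, ∫⁻ s in Icc a b,
          W ((0 : Fin (m + 2)).insertNth t (j.insertNth s x)) :=
      lintegral_lintegral_swap hmeas.aemeasurable
    have h2 : ∫⁻ s in Icc a b, g s ^ p * ∫⁻ t in Icc α β,
          W ((0 : Fin (m + 2)).insertNth t (j.insertNth s x)) =
        ∫⁻ t in Icc α β, ∫⁻ s in Icc a b,
          g s ^ p * W ((0 : Fin (m + 2)).insertNth t (j.insertNth s x)) := by
      have h3 : ∀ s, g s ^ p * ∫⁻ t in Icc α β,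
            W ((0 : Fin (m + 2)).insertNth t (j.insertNth s x)) =
          ∫⁻ t in Icc α β, g s ^ p * W ((0 : Fin (m + 2)).insertNth t (j.insertNth s x)) :=
        fun s => (lintegral_const_mul _
          (hmeas.comp (measurable_const.prodMk measurable_id))).symm
      simp only [h3]
      exact lintegral_lintegral_swap
        (((hg.pow_const p).comp measurable_fst).mul hmeas).aemeasurable
    rw [h1, h2, ← lintegral_const_mul _ hmeas'.lintegral_prod_right',
      ← lintegral_const_mul]
    · refine lintegral_mono_ae (ae_restrict_of_ae ?_)
      filter_upwards [hx] with t ht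
      exact ht a b hab g hg
    · exact Measurable.lintegral_prod_right' (ν := volume.restrict (Icc a b))
        (((hg.pow_const p).comp measurable_snd).mul hmeas')

/-- The induction hypothesis is applied to the integrals of `f` and `W` in the first coordinate; the
one-dimensional inequality on each slice then moves the power `p` inside, at the cost of one factor
`C`. -/
theorem SliceTest.box {p : ℝ} (hp : 1 ≤ p) {C : ℝ≥0∞} {n : ℕ} {W : (Fin n → ℝ) → ℝ≥0∞}
    (hW : Measurable W) (h : SliceTest p C n W) {a b : Fin n → ℝ} (hab : ∀ i, a i < b i)
    {f : (Fin n → ℝ) → ℝ≥0∞} (hf : Measurable f) :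
    (∫⁻ x in Icc a b, f x) ^ p * ∫⁻ x in Icc a b, W x ≤
      C ^ n * volume (Icc a b) ^ p * ∫⁻ x in Icc a b, f x ^ p * W x := by
  have hp0 : 0 ≤ p := by linarith
  induction n with
  | zero =>
    have hI : Icc a b = univ := eq_univ_of_forall fun x => by simp [Subsingleton.elim x a,
      Subsingleton.elim b a]
    rw [hI, Measure.restrict_univ, Measure.volume_pi_eq_dirac a]
    simp
  | succ n ih =>
    have hsec : Measurable fun z : (Fin n → ℝ) × ℝ =>
        ((0 : Fin (n + 1)).insertNth z.2 z.1 : Fin (n + 1) → ℝ) :=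
      (measurable_insertNth 0).comp measurable_swap
    have hfW : Measurable fun x => f x ^ p * W x := (hf.pow_const p).mul hW
    rw [setLIntegral_Icc_insertNth_zero a b hf, setLIntegral_Icc_insertNth_zero a b hW,
      setLIntegral_Icc_insertNth_zero a b hfW, volume_Icc_succ]
    have hI : ∀ {F : (Fin (n + 1) → ℝ) → ℝ≥0∞}, Measurable F → Measurable fun x : Fin n → ℝ =>
        ∫⁻ t in Icc (a 0) (b 0), F ((0 : Fin (n + 1)).insertNth t x) := fun hF =>
      Measurable.lintegral_prod_right' (ν := volume.restrict (Icc (a 0) (b 0))) (hF.comp hsec)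
    have h1 := ih (hI hW) (h.lintegral hW (a 0) (b 0))
      (a := Fin.tail a) (b := Fin.tail b) (fun i => hab i.succ)
      (hI hf)
    refine h1.trans ?_
    calc _ ≤ C ^ n * volume (Icc (Fin.tail a) (Fin.tail b)) ^ p *
          ∫⁻ x in Icc (Fin.tail a) (Fin.tail b), C * volume (Icc (a 0) (b 0)) ^ p *
            ∫⁻ t in Icc (a 0) (b 0), f ((0 : Fin (n + 1)).insertNth t x) ^ p *
              W ((0 : Fin (n + 1)).insertNth t x) := by
          refine mul_le_mul' le_rfl (lintegral_mono_ae (ae_restrict_of_ae ?_))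
          filter_upwards [h 0] with x hx
          exact hx (a 0) (b 0) (hab 0) (fun t => f ((0 : Fin (n + 1)).insertNth t x))
            ((hf.comp hsec).comp (measurable_const.prodMk measurable_id))
      _ = _ := by
        rw [lintegral_const_mul _ (hI hfW),
          ENNReal.mul_rpow_of_nonneg _ _ hp0, pow_succ]
        ring

/-- The testing inequality on a set implies the Muckenhoupt condition on it. -/
theorem measure_mul_rpow_le_of_test {α : Type*} [MeasurableSpace α] {μ : Measure α}
    [IsFiniteMeasure μ] (hμ : μ ≠ 0) {p : ℝ} (hp : 1 < p) {D : ℝ≥0∞} {u : α → ℝ≥0∞}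
    (hu : Measurable u) (hut : ∀ x, u x ≠ ∞) (hint : ∫⁻ x, u x ∂μ ≠ ∞)
    (h : ∀ f : α → ℝ≥0∞, Measurable f →
      (∫⁻ x, f x ∂μ) ^ p * ∫⁻ x, u x ∂μ ≤ D * ∫⁻ x, f x ^ p * u x ∂μ) :
    (∫⁻ x, u x ^ (-(1 / (p - 1))) ∂μ) ^ (p - 1) * ∫⁻ x, u x ∂μ ≤ D := by
  have hp1 : 0 < p - 1 := by linarith
  have hs : 0 < 1 / (p - 1) := by positivity
  set s := 1 / (p - 1) with hsdef
  -- The natural test function `u^(-s)` may have infinite integral. Adding `e k > 0` bounds it, so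
  -- that `Y` is finite and can be cancelled; monotone convergence removes `e k` at the end.
  let e : ℕ → ℝ≥0∞ := fun k => ((k : ℝ≥0∞) + 1)⁻¹
  have he0 : ∀ k, e k ≠ 0 := fun k =>
    ENNReal.inv_ne_zero.2 (ENNReal.add_ne_top.2 ⟨ENNReal.natCast_ne_top k, ENNReal.one_ne_top⟩)
  have het : ∀ k, e k ≠ ∞ := fun k => ENNReal.inv_ne_top.2 (by simp)
  have hfm : ∀ k, Measurable fun x => (u x + e k) ^ (-s) := fun k =>
    (hu.add_const _).pow_const _
  have hk : ∀ k, (∫⁻ x, (u x + e k) ^ (-s) ∂μ) ^ (p - 1) * ∫⁻ x, u x ∂μ ≤ D := by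
    intro k
    set Y := ∫⁻ x, (u x + e k) ^ (-s) ∂μ with hY
    have hYt : Y ≠ ∞ := by
      refine ne_top_of_le_ne_top (b := ∫⁻ _, (e k) ^ (-s) ∂μ) ?_ ?_
      · rw [lintegral_const]
        exact ENNReal.mul_ne_top (ENNReal.rpow_ne_top_of_ne_zero (he0 k) (het k))
          (measure_ne_top _ _)
      · refine lintegral_mono fun x => ?_
        simp only [ENNReal.rpow_neg]
        exact ENNReal.inv_le_inv.2 (ENNReal.rpow_le_rpow le_add_self hs.le)
    have hY0 : Y ≠ 0 := by
      rw [hY, Ne, lintegral_eq_zero_iff (hfm k)]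
      intro h0
      have : ∀ᵐ x ∂μ, False := by
        filter_upwards [h0] with x hx
        rw [Pi.zero_apply, ENNReal.rpow_eq_zero_iff] at hx
        rcases hx with ⟨_, hx⟩ | ⟨hx, _⟩
        · linarith
        · exact ENNReal.add_ne_top.2 ⟨hut x, het k⟩ hx
      rw [eventually_false_iff_eq_bot, ae_eq_bot] at this
      exact hμ this
    have h1 : Y ^ p * ∫⁻ x, u x ∂μ ≤ D * Y := by
      refine (h _ (hfm k)).trans ?_
      gcongr D * ?_
      refine lintegral_mono fun x => ?_
      have hx0 : u x + e k ≠ 0 := fun h => he0 k (add_eq_zero.1 h).2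
      have hxt : u x + e k ≠ ∞ := ENNReal.add_ne_top.2 ⟨hut x, het k⟩
      -- The exponents match because `-s * p + 1 = -s` for `s = 1 / (p - 1)`.
      calc ((u x + e k) ^ (-s)) ^ p * u x ≤ ((u x + e k) ^ (-s)) ^ p * (u x + e k) ^ (1 : ℝ) := by
            rw [ENNReal.rpow_one]
            gcongr
            exact le_self_add
        _ = (u x + e k) ^ (-s) := by
          rw [← ENNReal.rpow_mul, ← ENNReal.rpow_add _ _ hx0 hxt]
          congr 1
          rw [hsdef]
          field_simp
          ring
    have h2 : Y ^ p = Y ^ (p - 1) * Y := by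
      nth_rewrite 3 [← ENNReal.rpow_one Y]
      rw [← ENNReal.rpow_add _ _ hY0 hYt]
      ring_nf
    rw [← ENNReal.mul_le_mul_iff_left hY0 hYt]
    refine le_trans (le_of_eq ?_) h1
    rw [h2]
    ring
  have hlim : Tendsto (fun k => ∫⁻ x, (u x + e k) ^ (-s) ∂μ) atTop
      (𝓝 (∫⁻ x, u x ^ (-s) ∂μ)) := by
    refine lintegral_tendsto_of_tendsto_of_monotone (fun k => (hfm k).aemeasurable)
      (.of_forall fun x => ?_) (.of_forall fun x => ?_)
    · intro k l hkl
      simp only [ENNReal.rpow_neg]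
      refine ENNReal.inv_le_inv.2 (ENNReal.rpow_le_rpow ?_ hs.le)
      gcongr
      refine ENNReal.inv_le_inv.2 ?_
      gcongr
    · have h1 : Tendsto e atTop (𝓝 0) := by
        have := (tendsto_add_atTop_iff_nat 1).2 ENNReal.tendsto_inv_nat_nhds_zero
        simpa [e] using this
      have h2 : Tendsto (fun k => u x + e k) atTop (𝓝 (u x)) := by
        simpa using h1.const_add (u x)
      exact (ENNReal.continuous_rpow_const.tendsto _).comp h2
  have hlim2 := ENNReal.Tendsto.mul_const (b := ∫⁻ x, u x ∂μ)
    ((ENNReal.continuous_rpow_const (y := p - 1)).tendsto _ |>.comp hlim) (.inr hint)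
  exact le_of_tendsto hlim2 (.of_forall hk)

/-! ### From slices to rectangles -/

/-- A measurable representative of a weight, and its restriction to almost every slice. -/
lemma exists_measurable_representative {d : ℕ} {w : (Fin (d + 1) → ℝ) → ℝ}
    (hw : LocallyIntegrable w volume) :
    ∃ W : (Fin (d + 1) → ℝ) → ℝ≥0∞, Measurable W ∧ (∀ x, W x ≠ ∞) ∧
      (fun x => ENNReal.ofReal (w x)) =ᵐ[volume] W ∧
      ∀ j : Fin (d + 1), ∀ᵐ x : Fin d → ℝ,
        (fun t => ENNReal.ofReal (slice w j x t)) =ᵐ[volume] fun t => W (j.insertNth t x) := by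
  have hm := hw.aestronglyMeasurable.aemeasurable
  have hae : (fun x => ENNReal.ofReal (w x)) =ᵐ[volume] fun x => ENNReal.ofReal (hm.mk w x) := by
    filter_upwards [hm.ae_eq_mk] with x hx
    rw [← hx]
  exact ⟨fun x => ENNReal.ofReal (hm.mk w x), hm.measurable_mk.ennreal_ofReal,
    fun x => ENNReal.ofReal_ne_top, hae, fun j => ae_ae_insertNth j hae⟩

lemma volume_Icc_pi_ne_zero {n : ℕ} {a b : Fin n → ℝ} (hab : ∀ i, a i < b i) :
    volume (Icc a b) ≠ 0 := by
  rw [Real.volume_Icc_pi, Finset.prod_ne_zero_iff]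
  intro i _
  simpa using hab i

/-- If almost all slices of `w` are uniformly in `A_p`, then `w` satisfies the `A_p` condition on
rectangles. -/
theorem recApConst_le_pow {d : ℕ} {w : (Fin (d + 1) → ℝ) → ℝ} (hw : LocallyIntegrable w volume)
    {p : ℝ} (hp : 1 < p) {C : ℝ≥0∞} (hC : C ≠ ∞) (h : strongApConst p w ≤ C) :
    recApConst p w ≤ C ^ (d + 1) := by
  have hp1 : 0 < p - 1 := by linarith
  obtain ⟨W, hW, hWt, hwW, hsl⟩ := exists_measurable_representative hw
  have hS : SliceTest p C (d + 1) W := by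
    intro j
    have h1 : ∀ᵐ x : Fin d → ℝ, apConst p (slice w j x) ≤ C := by
      filter_upwards [ENNReal.ae_le_essSup fun x : Fin d → ℝ => apConst p (slice w j x)] with x hx
      exact hx.trans ((le_iSup (fun j => essSup
        (fun x : Fin d → ℝ => apConst p (slice w j x)) volume) j).trans h)
    filter_upwards [h1, ae_locallyIntegrable_slice hw j, hsl j] with x hx1 hx2 hx3
    exact (testIneq_of_apConst_le hx2.aestronglyMeasurable.aemeasurable hp hC hx1).congr hx3
  refine iSup_le fun a => iSup_le fun b => iSup_le fun hab => ?_
  have hv0 := volume_Icc_pi_ne_zero hab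
  have hvt : volume (Icc a b) ≠ ∞ := isCompact_Icc.measure_lt_top.ne
  have e1 : ∫⁻ x in Icc a b, ENNReal.ofReal (w x) = ∫⁻ x in Icc a b, W x :=
    lintegral_congr_ae (ae_restrict_of_ae hwW)
  have e2 : ∫⁻ x in Icc a b, ENNReal.ofReal (w x) ^ (-(1 / (p - 1))) =
      ∫⁻ x in Icc a b, W x ^ (-(1 / (p - 1))) := by
    refine lintegral_congr_ae (ae_restrict_of_ae ?_)
    filter_upwards [hwW] with x hx
    rw [hx]
  have : IsFiniteMeasure (volume.restrict (Icc a b)) := ⟨by simpa using hvt.lt_top⟩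
  have key := measure_mul_rpow_le_of_test (μ := volume.restrict (Icc a b))
    (by simpa [Measure.restrict_eq_zero] using hv0) hp hW hWt
    (by
      rw [← e1]
      exact (hw.integrableOn_isCompact isCompact_Icc).lintegral_lt_top.ne)
    (fun f hf => hS.box hp.le hW hab hf)
  rw [apExpr, if_neg hp.ne', setLAverage_eq, setLAverage_eq, e1, e2,
    ENNReal.div_rpow_of_nonneg _ _ hp1.le]
  have hvol : volume (Icc a b) * volume (Icc a b) ^ (p - 1) = volume (Icc a b) ^ p := by
    nth_rewrite 1 [← ENNReal.rpow_one (volume (Icc a b))]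
    rw [← ENNReal.rpow_add _ _ hv0 hvt]
    ring_nf
  have hvp0 : volume (Icc a b) ^ (p - 1) ≠ 0 :=
    (ENNReal.rpow_pos (pos_iff_ne_zero.2 hv0) hvt).ne'
  have hvpt : volume (Icc a b) ^ (p - 1) ≠ ∞ := ENNReal.rpow_ne_top_of_nonneg hp1.le hvt
  rw [div_eq_mul_inv, div_eq_mul_inv, mul_mul_mul_comm,
    ← ENNReal.mul_inv (.inl hv0) (.inl hvt), hvol, ← div_eq_mul_inv]
  refine ENNReal.div_le_of_le_mul ?_
  rwa [mul_comm]

lemma recApConst_eq_zero {d : ℕ} {w : (Fin (d + 1) → ℝ) → ℝ} (hw : LocallyIntegrable w volume)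
    (p : ℝ) (h : ∀ᵐ x : Fin d → ℝ, ∀ a b, a < b →
      ∫⁻ t in Icc a b, ENNReal.ofReal (slice w 0 x t) = 0) : recApConst p w = 0 := by
  obtain ⟨W, hW, -, hwW, hsl⟩ := exists_measurable_representative hw
  simp only [recApConst, ENNReal.iSup_eq_zero]
  intro a b hab
  have h0 : ∫⁻ x in Icc a b, ENNReal.ofReal (w x) = 0 := by
    rw [lintegral_congr_ae (ae_restrict_of_ae hwW), setLIntegral_Icc_insertNth_zero a b hW]
    refine lintegral_eq_zero_of_ae_eq_zero (ae_restrict_of_ae ?_)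
    filter_upwards [h, hsl 0] with x hx1 hx2
    rw [← lintegral_congr_ae (ae_restrict_of_ae hx2)]
    exact hx1 _ _ (hab 0)
  rw [apExpr, setLAverage_eq, h0]
  simp

lemma ae_aInftyConst_slice_le {d : ℕ} (w : (Fin (d + 1) → ℝ) → ℝ) (j : Fin (d + 1)) :
    ∀ᵐ x : Fin d → ℝ, aInftyConst (slice w j x) ≤ strongAInftyConst w := by
  filter_upwards [ENNReal.ae_le_essSup fun x : Fin d → ℝ => aInftyConst (slice w j x)] with x hx
  exact hx.trans (le_iSup (fun j => essSup
    (fun x : Fin d → ℝ => aInftyConst (slice w j x)) volume) j)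

end StrongWeights

theorem mainTheorem4 :
    ∃ c : ℝ, 0 < c ∧
      ∀ (d : ℕ) (w : (Fin (d + 1) → ℝ) → ℝ), StrongWeights.MemStrongAInfty w →
        ∀ p : ℝ, Real.exp (c * (StrongWeights.strongAInftyConst w).toReal) ≤ p →
          StrongWeights.MemStrongAp p w ∧
          StrongWeights.strongApConst p w ≤
            ENNReal.ofReal
              (Real.exp (Real.exp (c * p * (StrongWeights.strongAInftyConst w).toReal))) := by
  refine ⟨100, by norm_num, fun d w hw p hp => ?_⟩
  obtain ⟨hwt, hfin⟩ := hw
  set A := (StrongWeights.strongAInftyConst w).toReal with hA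
  have hAe : StrongWeights.strongAInftyConst w = ENNReal.ofReal A :=
    (ENNReal.ofReal_toReal hfin.ne).symm
  -- Below 1 almost every slice has zero mass, so all constants vanish. This case includes `p = 1`,
  -- which is excluded once `A ≥ 1`.
  rcases lt_or_ge A 1 with hA1 | hA1
  · have hz : ∀ j : Fin (d + 1), ∀ᵐ x : Fin d → ℝ, ∀ a b, a < b →
        ∫⁻ t in Icc a b, ENNReal.ofReal (StrongWeights.slice w j x t) = 0 := by
      intro j
      filter_upwards [StrongWeights.ae_aInftyConst_slice_le w j,
        StrongWeights.ae_locallyIntegrable_slice hwt.2 j] with x hx1 hx2 a b hab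
      refine StrongWeights.lintegral_eq_zero_of_aInftyConst_lt_one hx2 (hx1.trans_lt ?_) hab
      rw [hAe]
      exact ENNReal.ofReal_lt_one.2 hA1
    refine ⟨⟨hwt, ?_⟩, iSup_le fun j => essSup_le_of_ae_le _ ?_⟩
    · rw [StrongWeights.recApConst_eq_zero hwt.2 p (hz 0)]
      exact ENNReal.zero_lt_top
    · filter_upwards [hz j] with x hx
      rw [StrongWeights.apConst_eq_zero p hx]
      exact zero_le
  · have hp1 : 1 < p := lt_of_lt_of_le (Real.one_lt_exp_iff.2 (by linarith)) hp
    have hS : StrongWeights.strongApConst p w ≤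
        ENNReal.ofReal (Real.exp (Real.exp (100 * p * A))) := by
      refine iSup_le fun j => essSup_le_of_ae_le _ ?_
      filter_upwards [StrongWeights.ae_aInftyConst_slice_le w j,
        StrongWeights.ae_locallyIntegrable_slice hwt.2 j] with x hx1 hx2
      exact StrongWeights.apConst_le_exp hx2 hA1 (hAe ▸ hx1) hp
    refine ⟨⟨hwt, ?_⟩, hS⟩
    exact (StrongWeights.recApConst_le_pow hwt.2 hp1 ENNReal.ofReal_ne_top hS).trans_lt
      (ENNReal.pow_lt_top ENNReal.ofReal_lt_top)
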